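/- A domain (non-empty connected open set) $D\subset\mathbb C^n$ is called proper if $D\neq\mathbb C^n$, and $\mathbb C$-convex if each non-empty intersection of $D$ with a complex line is contractible. Let $d_D(w)$ be the Euclidean distance from $w$ to $\partial D$, and let $$c_D(z,w)=\sup\{\tanh^{-1}|f(w)| : f\colon D\to\mathbb D \text{ holomorphic},\ f(z)=0\}$$ be the Carathéodory distance, where $\mathbb D$ is the open unit disc. Let $L^2_h(D)$ be the space of square-integrable holomorphic functions on $D$ with the $L^2$-norm $\|\cdot\|_D$. For bounded $D$ put $$K_D(z)=\sup\{|f(z)|^2: f\in L_h^2(D),\ \|f\|_D\le 1\},\qquad M_D(z;X)=\sup\{|f'(z)X|: f\in L_h^2(D),\ \|f\|_D=1,\ f(z)=0\},$$ $$b_D(z,w)=\inf_\gamma\int_0^1\frac{M_D(\gamma(t);\gamma'(t))}{\sqrt{K_D(\gamma(t))}}\,dt,$$ where the infimum is over all smooth curves $\gamma:[0,1]\to D$ with $\gamma(0)=z$ and $\gamma(1)=w$ (the Bergman distance). **Proposition.** Let $D$ be a proper $\mathbb C$-convex domain in $\mathbb C^n$. Then for all $z,w\in D$, $$c_D(z,w)\ge\frac14\log\frac{d_D(z)}{4d_D(w)}.$$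 If, in addition, $D$ is bounded, then for every compact subset $K$ of $D$ there is a constant $c_K>0$ such that $$b_D(z,w)\ge-\frac14\log d_D(w)-c_K,\qquad z\in K,\ w\in D.$$ -/

import Mathlib

open Set MeasureTheory
open scoped ENNReal ContDiff

noncomputable section

/-- A set in `ℂⁿ` is `ℂ`-convex if its intersection with every complex line that meets it is
contractible. (Mathlib's `ContractibleSpace` excludes the empty space; an empty intersection
is allowed here.) -/
def IsCConvex {n : ℕ} (D : Set (EuclideanSpace ℂ (Fin n))) : Prop :=
  ∀ L : AffineSubspace ℂ (EuclideanSpace ℂ (Fin n)), Module.finrank ℂ L.direction = 1 →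
    (D ∩ (L : Set (EuclideanSpace ℂ (Fin n)))).Nonempty →
      ContractibleSpace ↥(D ∩ (L : Set (EuclideanSpace ℂ (Fin n))))

/-- The distance `d_D(w)` from `w` to the boundary of `D`. -/
def bdryDist {n : ℕ} (D : Set (EuclideanSpace ℂ (Fin n))) (w : EuclideanSpace ℂ (Fin n)) : ℝ :=
  Metric.infDist w (frontier D)

/-- The Carathéodory distance of the open set `D`: the supremum of `tanh⁻¹ |f w|` over all
holomorphic maps `f` from `D` to the open unit disc with `f z = 0`. -/
def caratheodoryDist {n : ℕ} (D : Set (EuclideanSpace ℂ (Fin n)))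
    (z w : EuclideanSpace ℂ (Fin n)) : ℝ≥0∞ :=
  ⨆ f ∈ {f : EuclideanSpace ℂ (Fin n) → ℂ |
      DifferentiableOn ℂ f D ∧ MapsTo f D (Metric.ball 0 1) ∧ f z = 0},
    ENNReal.ofReal (Real.artanh ‖f w‖)

/-- `L²_h(D)`: the functions that are holomorphic and square-integrable on the open set `D`. -/
def bergmanSpace {n : ℕ} (D : Set (EuclideanSpace ℂ (Fin n))) :
    Set (EuclideanSpace ℂ (Fin n) → ℂ) :=
  {f | DifferentiableOn ℂ f D ∧ MemLp f 2 (volume.restrict D)}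

/-- The Bergman kernel on the diagonal,
`K_D(z) = sup {|f(z)|² : f ∈ L²_h(D), ‖f‖_D ≤ 1}`. -/
def bergmanKernelDiag {n : ℕ} (D : Set (EuclideanSpace ℂ (Fin n)))
    (z : EuclideanSpace ℂ (Fin n)) : ℝ≥0∞ :=
  ⨆ f ∈ {f | f ∈ bergmanSpace D ∧ eLpNorm f 2 (volume.restrict D) ≤ 1}, ‖f z‖ₑ ^ 2

/-- `M_D(z;X) = sup {|f'(z)X| : f ∈ L²_h(D), ‖f‖_D = 1, f(z) = 0}`. -/
def bergmanM {n : ℕ} (D : Set (EuclideanSpace ℂ (Fin n)))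
    (z X : EuclideanSpace ℂ (Fin n)) : ℝ≥0∞ :=
  ⨆ f ∈ {f | f ∈ bergmanSpace D ∧ eLpNorm f 2 (volume.restrict D) = 1 ∧ f z = 0},
    ‖fderiv ℂ f z X‖ₑ

/-- The Bergman metric `β_D(z;X) = M_D(z;X) / √K_D(z)`. -/
def bergmanMetric {n : ℕ} (D : Set (EuclideanSpace ℂ (Fin n)))
    (z X : EuclideanSpace ℂ (Fin n)) : ℝ≥0∞ :=
  bergmanM D z X / bergmanKernelDiag D z ^ (1 / 2 : ℝ)

/-- The Bergman distance: the infimum of the `β_D`-lengths of the smooth curves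
`γ : [0,1] → D` from `z` to `w`. -/
def bergmanDist {n : ℕ} (D : Set (EuclideanSpace ℂ (Fin n)))
    (z w : EuclideanSpace ℂ (Fin n)) : ℝ≥0∞ :=
  ⨅ γ ∈ {γ : ℝ → EuclideanSpace ℂ (Fin n) |
      ContDiffOn ℝ ∞ γ (Icc 0 1) ∧ MapsTo γ (Icc 0 1) D ∧ γ 0 = z ∧ γ 1 = w},
    ∫⁻ t in Icc (0 : ℝ) 1, bergmanMetric D (γ t) (derivWithin γ (Icc 0 1) t)

end

/-! Let a be a boundary point nearest to w. A ℂ-convex open set is linearly convex, so some complex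
hyperplane ℓ(x - a) = 0 through a misses D. The projection G = ℓ(D - a) is a plane domain omitting 0
on which nonvanishing continuous functions have logarithms. The ball of radius d_D(z) about z misses
the hyperplane, so |ℓ(z - a)| ≥ ‖ℓ‖ d_D(z), while |ℓ(w - a)| ≤ ‖ℓ‖ d_D(w) by the choice of a
(`exists_projection`).

On G, Koebe's one-quarter theorem bounds the Carathéodory metric at ζ below by 1/(4|ζ|)
(`exists_deriv_ge`), and the Carathéodory distance by a quarter of log(|z|/|w|)
(`log_div_le_of_artanh_le`). Composition with ℓ carries both to D. The Bergman metric dominates the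
Carathéodory metric (`enorm_fderiv_le_bergmanMetric`), so integrating d log ℓ(γ - a) along a curve γ
bounds its Bergman length. Both bounds come out as (1/4) log(d_D(z)/d_D(w)), without the factor 4 in
the denominator.

Topology enters only through `LineLog`. Linear convexity (`LineLog.exists_hyperplane`) holds because
otherwise a pencil of subspaces, all meeting D and with axis missing D, would produce a continuous
logarithm of u on ℂ \ {0}. Koebe's theorem comes from a comparison of logarithmic areas
(`norm_deriv_le_one_of_mul_ne_one`). The Riemann map is replaced by conformal embeddings into the
disc whose images contain the discs of radius ρ < 1, followed by ρ → 1. -/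

/-- Every continuous nonvanishing function on `S` has a continuous logarithm. -/
def HasContLog {X : Type*} [TopologicalSpace X] (S : Set X) : Prop :=
  ∀ h : X → ℂ, ContinuousOn h S → (∀ x ∈ S, h x ≠ 0) →
    ∃ b : X → ℂ, ContinuousOn b S ∧ ∀ x ∈ S, Complex.exp (b x) = h x

/-- The slices of `D` by complex lines are connected and have continuous logarithms. -/
def LineLog {E : Type*} [AddCommGroup E] [Module ℂ E] (D : Set E) : Prop :=
  ∀ p v : E, IsPreconnected {c : ℂ | p + c • v ∈ D} ∧ HasContLog {c : ℂ | p + c • v ∈ D}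

/-! ### Continuous logarithms in families -/

section ContinuousLogarithms

open Topology unitInterval

theorem continuous_log_homotopy {A : Type*} [TopologicalSpace A] {h g : I × A → ℂ}
    (hh : Continuous h) (hg : ∀ x, Complex.exp (g x) = h x)
    (h0 : Continuous fun a => g (0, a)) (hA : ∀ a, Continuous fun t => g (t, a)) :
    Continuous g := by
  have h0' : ∀ x, h x ≠ 0 := fun x => by rw [← hg]; exact Complex.exp_ne_zero _
  refine Complex.isCoveringMap_exp.isLocalHomeomorph.continuous_lift
    Complex.isCoveringMap_exp.isSeparatedMap
    ⟨fun x => (⟨h x, h0' x⟩ : {z : ℂ // z ≠ 0}), by fun_prop⟩ ?_ h0 hA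
  funext x
  exact Subtype.ext (hg x)

theorem eqOn_of_exp_eqOn {X : Type*} [TopologicalSpace X] {S : Set X} (hS : IsPreconnected S)
    {b₁ b₂ : X → ℂ} (h₁ : ContinuousOn b₁ S) (h₂ : ContinuousOn b₂ S)
    (he : ∀ x ∈ S, Complex.exp (b₁ x) = Complex.exp (b₂ x)) {x₀ : X} (hx₀ : x₀ ∈ S)
    (h : b₁ x₀ = b₂ x₀) : EqOn b₁ b₂ S :=
  Complex.isCoveringMap_exp.eqOn_of_comp_eqOn hS h₁ h₂
    (fun x hx => Subtype.ext (he x hx)) hx₀ h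

/-- Carries continuity in the base parameter from the start to the end of a family of paths inside
the fibres. Across fibres `b` need not be continuous beforehand; homotopy lifting for the covering
`exp` supplies this. -/
theorem continuous_log_endpoint {A X F : Type*} [TopologicalSpace A] [TopologicalSpace X]
    [TopologicalSpace F] {Y : Set (X × F)} {h b : X × F → ℂ}
    (hh : ContinuousOn h Y) (hb : ∀ y ∈ Y, Complex.exp (b y) = h y)
    (hfib : ∀ u, ContinuousOn (fun q => b (u, q)) {q | (u, q) ∈ Y}) {a : A → X}
    (ha : Continuous a) {φ : I × A → F} (hφ : Continuous φ) (hY : ∀ x : I × A, (a x.2, φ x) ∈ Y)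
    (hc : Continuous fun y => b (a y, φ (0, y))) : Continuous fun y => b (a y, φ (1, y)) := by
  have : Continuous fun x : I × A => b (a x.2, φ x) := by
    refine continuous_log_homotopy (h := fun x => h (a x.2, φ x))
      (hh.comp_continuous (by fun_prop) hY) (fun x => hb _ (hY x)) hc fun y => ?_
    exact (hfib (a y)).comp_continuous (f := fun t => φ (t, y)) (by fun_prop)
      (fun t => hY (t, y))
  exact this.comp (by fun_prop : Continuous fun y : A => ((1 : I), y))

/-- Continuity along one section `q₀` spreads over the fibre. Join `q₀` to `q` in the fibre over
`u₀`; by the tube lemma the path stays in nearby fibres. Then use straight segments to fill a ball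
around `q`. -/
theorem continuousAt_of_fiberwise {X F : Type*} [TopologicalSpace X] [NormedAddCommGroup F]
    [NormedSpace ℝ F] {Y : Set (X × F)} (hY : IsOpen Y) {h b : X × F → ℂ}
    (hh : ContinuousOn h Y) (hb : ∀ y ∈ Y, Complex.exp (b y) = h y)
    (hfib : ∀ u, ContinuousOn (fun q => b (u, q)) {q | (u, q) ∈ Y}) {u₀ : X} {q₀ q : F}
    (hcon : IsPreconnected {q | (u₀, q) ∈ Y}) (h0 : (u₀, q₀) ∈ Y) (hq : (u₀, q) ∈ Y)
    (hs : ∀ᶠ u in 𝓝 u₀, ContinuousAt (fun u => b (u, q₀)) u) : ContinuousAt b (u₀, q) := by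
  have hopen : IsOpen {q | (u₀, q) ∈ Y} := hY.preimage (by fun_prop)
  obtain ⟨γ, hγ⟩ := (hopen.isConnected_iff_isPathConnected.mp ⟨⟨q₀, h0⟩, hcon⟩).joinedIn q₀ h0 q hq
  have htube : ∀ᶠ u in 𝓝 u₀, ∀ t, (u, γ t) ∈ Y := by
    have := (isCompact_univ (X := I)).eventually_forall_of_forall_eventually
      (x₀ := u₀) (P := fun u t => (u, γ t) ∈ Y) (fun t _ => by
        have : Continuous fun z : X × I => (z.1, γ z.2) := by fun_prop
        exact this.continuousAt.eventually_mem (hY.mem_nhds (hγ t)))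
    simpa using this
  obtain ⟨N, hN, hNo, huN⟩ := eventually_nhds_iff.mp (htube.and hs)
  have h1 : ∀ u ∈ N, ContinuousAt (fun u => b (u, q)) u := by
    have hc : Continuous fun u : N => b (u, q₀) :=
      (continuousOn_iff_continuous_domRestrict (f := fun u => b (u, q₀))).mp
        fun u hu => (hN u hu).2.continuousWithinAt
    have : Continuous fun u : N => b (u, q) := by
      have := continuous_log_endpoint hh hb hfib (A := N) (a := fun u => u) (by fun_prop)
        (φ := fun x => γ x.1) (by fun_prop) (fun x => (hN x.2 x.2.2).1 x.1) (by simpa using hc)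
      simpa using this
    intro u hu
    exact ((continuousOn_iff_continuous_domRestrict (f := fun u => b (u, q))).mpr
      this).continuousAt (hNo.mem_nhds hu)
  obtain ⟨U, hU, V, hV, hUV⟩ := mem_nhds_prod_iff.mp (hY.mem_nhds hq)
  obtain ⟨r, hr, hrV⟩ := Metric.mem_nhds_iff.mp hV
  obtain ⟨U', hU', hU'o, huU'⟩ := mem_nhds_iff.mp (Filter.inter_mem hU (hNo.mem_nhds huN))
  let B : Set (X × F) := U' ×ˢ Metric.ball q r
  have hB : Continuous fun z : B => b (z.1.1, z.1.2) := by
    have := continuous_log_endpoint hh hb hfib (A := B) (a := fun z => z.1.1) (by fun_prop)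
      (φ := fun x => q + (x.1 : ℝ) • (x.2.1.2 - q)) (by fun_prop)
      (fun x => hUV ⟨(hU' x.2.2.1).1, hrV (by
        have h2 := x.2.2.2
        simp only [Metric.mem_ball, dist_eq_norm] at h2 ⊢
        rw [add_sub_cancel_left, norm_smul, Real.norm_of_nonneg x.1.2.1]
        exact lt_of_le_of_lt (mul_le_of_le_one_left (norm_nonneg _) x.1.2.2) h2)⟩) (by
          simp only [Icc.coe_zero, zero_smul, add_zero]
          rw [continuous_iff_continuousAt]
          intro z
          exact (h1 z.1.1 (hU' z.2.1).2).comp (f := fun z : B => z.1.1)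
            (by fun_prop : Continuous fun z : B => z.1.1).continuousAt)
    simpa using this
  exact ((continuousOn_iff_continuous_domRestrict (f := b) (s := B)).mpr hB).continuousAt
    ((hU'o.prod Metric.isOpen_ball).mem_nhds ⟨huU', Metric.mem_ball_self hr⟩)

theorem continuousAt_log_shift {X : Type*} [TopologicalSpace X] {h : X → ℂ} {x₀ : X}
    (hh : ContinuousAt h x₀) (h0 : h x₀ ≠ 0) :
    ∀ᶠ x in 𝓝 x₀, h x / h x₀ ∈ Complex.slitPlane := by
  have : ContinuousAt (fun x => h x / h x₀) x₀ := hh.div_const _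
  exact this.eventually_mem (Complex.isOpen_slitPlane.mem_nhds (by simp [h0]))

variable {E : Type*} [NormedAddCommGroup E] [NormedSpace ℂ E]

theorem LineLog.isPreconnected {D : Set E} (hD : LineLog D) : IsPreconnected D := by
  refine isPreconnected_of_forall_pair fun x hx y hy => ?_
  refine ⟨(fun c : ℂ => x + c • (y - x)) '' {c | x + c • (y - x) ∈ D}, ?_, ?_, ?_, ?_⟩
  · rintro _ ⟨c, hc, rfl⟩; exact hc
  · exact ⟨0, by simpa using hx, by simp⟩
  · exact ⟨1, by simpa using hy, by simp⟩
  · exact (hD x (y - x)).1.image _ (by fun_prop)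

/-- Sweep `D` by the complex lines through a fixed `p`, parametrised by a second point `y`.
Logarithms on these lines, all normalised to the same value at `p`, fit together; the value at `c =
1` is the logarithm at `y`. -/
theorem LineLog.hasContLog {D : Set E} (hD : LineLog D) (hDo : IsOpen D) : HasContLog D := by
  intro h hh hne
  rcases D.eq_empty_or_nonempty with rfl | ⟨p, hp⟩
  · exact ⟨0, by simp, by simp⟩
  let Y : Set (E × ℂ) := {z | p + z.2 • (z.1 - p) ∈ D}
  have hY : IsOpen Y := hDo.preimage (by fun_prop)
  have hhY : ContinuousOn (fun z : E × ℂ => h (p + z.2 • (z.1 - p))) Y :=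
    hh.comp (by fun_prop) fun z hz => hz
  have hex : ∀ y, ∃ b : ℂ → ℂ, ContinuousOn b {c | p + c • (y - p) ∈ D} ∧
      (∀ c ∈ {c | p + c • (y - p) ∈ D}, Complex.exp (b c) = h (p + c • (y - p))) ∧
      b 0 = Complex.log (h p) := by
    intro y
    obtain ⟨b, hb, hbe⟩ := (hD p (y - p)).2 (fun c => h (p + c • (y - p)))
      (hh.comp (by fun_prop) fun c hc => hc) fun c hc => hne _ hc
    refine ⟨fun c => b c - b 0 + Complex.log (h p), by fun_prop, fun c hc => ?_, by simp⟩
    have h0 := hbe 0 (by simpa using hp)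
    rw [Complex.exp_add, Complex.exp_sub, hbe c hc, h0, Complex.exp_log (hne p hp)]
    simp only [zero_smul, add_zero]
    field_simp [hne p hp]
  choose b hb hbe hb0 using hex
  have hcont : ∀ y ∈ D, ContinuousAt (fun z : E × ℂ => b z.1 z.2) (y, 1) := by
    intro y hy
    refine continuousAt_of_fiberwise (Y := Y) hY hhY (fun z hz => hbe _ _ hz) (fun u => hb u)
      (q₀ := 0) (hD p (y - p)).1 (by simpa [Y] using hp) (by simpa [Y] using hy) ?_
    simp only [hb0]
    exact Filter.Eventually.of_forall fun _ => continuousAt_const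
  refine ⟨fun y => b y 1, fun y hy => ?_, fun y hy => ?_⟩
  · exact ((hcont y hy).comp (f := fun y : E => (y, (1 : ℂ))) (by fun_prop)).continuousWithinAt
  · simpa using hbe y 1 (by simpa using hy)

/-- Non-injective `f` is allowed because `LineLog` includes the degenerate lines `v = 0`, whose
slices are empty or all of ℂ. -/
theorem LineLog.preimage {F : Type*} [AddCommGroup F] [Module ℂ F] {D : Set E}
    (hD : LineLog D) (f : F →ₗ[ℂ] E) : LineLog (f ⁻¹' D) := by
  intro p v
  simpa using hD (f p) (f v)

theorem LineLog.vadd {D : Set E} (hD : LineLog D) (a : E) : LineLog {x | x + a ∈ D} := by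
  intro p v
  simpa [add_right_comm] using hD (p + a) v

/-- A continuous nonvanishing function on the total space of a family over `ℂ` whose fibres are
connected and have logarithms has a logarithm. -/
theorem exists_log_family {F : Type*} [NormedAddCommGroup F] [NormedSpace ℝ F]
    (hX : HasContLog (univ : Set ℂ)) {Y : Set (ℂ × F)} (hY : IsOpen Y)
    (hne : ∀ u, {q | (u, q) ∈ Y}.Nonempty) (hcon : ∀ u, IsPreconnected {q | (u, q) ∈ Y})
    (hlog : ∀ u, HasContLog {q | (u, q) ∈ Y}) {h : ℂ × F → ℂ} (hh : ContinuousOn h Y)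
    (h0 : ∀ y ∈ Y, h y ≠ 0) :
    ∃ b : ℂ × F → ℂ, ContinuousOn b Y ∧ ∀ y ∈ Y, Complex.exp (b y) = h y := by
  choose q hq using hne
  have hfo : ∀ u, IsOpen {q | (u, q) ∈ Y} := fun u => hY.preimage (by fun_prop)
  have hex : ∀ u, ∃ b : F → ℂ, ContinuousOn b {q | (u, q) ∈ Y} ∧
      ∀ q ∈ {q | (u, q) ∈ Y}, Complex.exp (b q) = h (u, q) := fun u =>
    hlog u (fun q => h (u, q)) (hh.comp (by fun_prop) fun q hq => hq) fun q hq => h0 _ hq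
  choose b hb hbe using hex
  have hN : ∀ i, ∃ N : Set ℂ, IsOpen N ∧ i ∈ N ∧ ∀ u ∈ N, (u, q i) ∈ Y ∧
      h (u, q i) / h (i, q i) ∈ Complex.slitPlane := by
    intro i
    have hc : ContinuousAt (fun u => h (u, q i)) i :=
      (hh.continuousAt (hY.mem_nhds (hq i))).comp (f := fun u : ℂ => (u, q i)) (by fun_prop)
    have hm : ∀ᶠ u in 𝓝 i, (u, q i) ∈ Y :=
      (by fun_prop : Continuous fun u : ℂ => (u, q i)).continuousAt.eventually_mem
        (hY.mem_nhds (hq i))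
    obtain ⟨N, h1, h2, h3⟩ :=
      eventually_nhds_iff.mp (hm.and (continuousAt_log_shift hc (h0 _ (hq i))))
    exact ⟨N, h2, h3, h1⟩
  choose N hNo hiN hN using hN
  -- The chosen logarithms `b u` are unrelated for different `u`. The correction `κ i u`, a multiple
  -- of 2πi, makes `b u` agree at `q i` with a branch continuous in `u` near `i`.
  let κ : ℂ → ℂ → ℂ := fun i u => Complex.log (h (u, q i) / h (i, q i)) +
    Complex.log (h (i, q i)) - b u (q i)
  have hκ : ∀ i, ∀ u ∈ N i, Complex.exp (κ i u) = 1 := by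
    intro i u hu
    have h1 := h0 _ (hq i)
    have h2 := h0 _ (hN i u hu).1
    simp only [κ]
    rw [Complex.exp_sub, Complex.exp_add, Complex.exp_log (div_ne_zero h2 h1),
      Complex.exp_log h1, hbe u _ (hN i u hu).1]
    field_simp
  have hβ : ∀ i, ∀ z ∈ Y, z.1 ∈ N i →
      ContinuousAt (fun z : ℂ × F => b z.1 z.2 + κ i z.1) z := by
    rintro i ⟨u, p⟩ hz hu
    refine continuousAt_of_fiberwise (X := ℂ) (Y := Y ∩ {z | z.1 ∈ N i})
      (h := h) (hY.inter ((hNo i).preimage continuous_fst)) (hh.mono inter_subset_left)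
      (fun z hz => ?_) (fun u => ?_) (q₀ := q i) ?_ ⟨(hN i u hu).1, hu⟩ ⟨hz, hu⟩ ?_
    · rw [Complex.exp_add, hκ i _ hz.2, hbe _ _ hz.1, mul_one]
    · exact ((hb u).mono fun q hq => hq.1).add (continuousOn_const (c := κ i u))
    · have : {q | (u, q) ∈ Y ∩ {z | z.1 ∈ N i}} = {q | (u, q) ∈ Y} := by
        ext q; simp [hu]
      rw [this]; exact hcon u
    · filter_upwards [(hNo i).mem_nhds hu] with u hu
      have : (fun u => b u (q i) + κ i u) = fun u =>
          Complex.log (h (u, q i) / h (i, q i)) + Complex.log (h (i, q i)) := by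
        funext u; simp only [κ]; ring
      simp only [this]
      have hc : ContinuousAt (fun u => h (u, q i)) u :=
        (hh.continuousAt (hY.mem_nhds (hN i u hu).1)).comp
          (f := fun u : ℂ => (u, q i)) (by fun_prop)
      exact ((hc.div_const _).clog (hN i u hu).2).add continuousAt_const
  obtain ⟨ρ, hρ⟩ := PartitionOfUnity.exists_isSubordinate isClosed_univ N hNo
    (fun u _ => mem_iUnion.mpr ⟨u, hiN u⟩)
  -- Averaging the local logarithms destroys `exp β = h`, but only by a factor `m` depending on `u`
  -- alone. That factor is a nonvanishing continuous function on ℂ and has a logarithm by `hX`.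
  let β : ℂ × F → ℂ := fun z => ∑ᶠ i, ρ i z.1 • (b z.1 z.2 + κ i z.1)
  have hβc : ContinuousOn β Y := by
    rw [continuousOn_iff_continuous_domRestrict]
    refine continuous_finsum (f := fun i (y : Y) =>
      ρ i y.1.1 • (b y.1.1 y.1.2 + κ i y.1.1)) (fun i => ?_) ?_
    · rw [continuous_iff_continuousAt]
      intro y
      -- The corrected logarithm is known to be continuous only over `N i`; off the support of `ρ i`
      -- the term vanishes locally.
      by_cases hy : y.1.1 ∈ tsupport (ρ i)
      · have h1 : ContinuousAt (fun y : Y => (ρ i) y.1.1) y := by fun_prop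
        exact h1.smul ((hβ i y.1 y.2 (hρ i hy)).comp (f := fun y : Y => y.1) (by fun_prop))
      · have h1 : ∀ᶠ u in 𝓝 y.1.1, ρ i u = 0 := notMem_tsupport_iff_eventuallyEq.mp hy
        have h2 : ∀ᶠ z : Y in 𝓝 y, ρ i z.1.1 = 0 :=
          (by fun_prop : Continuous fun z : Y => z.1.1).continuousAt.eventually h1
        refine (continuousAt_const (y := (0 : ℂ))).congr ?_
        filter_upwards [h2] with z hz
        rw [hz, zero_smul]
    · refine (ρ.locallyFinite.preimage_continuous
        (by fun_prop : Continuous fun z : Y => z.1.1)).subset fun i => ?_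
      intro z hz
      simp only [mem_preimage, Function.mem_support] at hz ⊢
      exact fun h => hz (by rw [h, zero_smul])
  have hβe : ∀ u q, β (u, q) = b u q + ∑ᶠ i, ρ i u • κ i u := by
    intro u q
    have hfin : (Function.support fun i => ρ i u).Finite := ρ.locallyFinite.point_finite u
    simp only [β, smul_add]
    rw [finsum_add_distrib, ← finsum_smul, ρ.sum_eq_one (mem_univ u), one_smul]
    · exact hfin.subset fun i hi h => hi (by simp [h])
    · exact hfin.subset fun i hi h => hi (by simp [h])
  let m : ℂ → ℂ := fun u => Complex.exp (-∑ᶠ i, ρ i u • κ i u)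
  have hm : ∀ z ∈ Y, h z = Complex.exp (β z) * m z.1 := by
    rintro ⟨u, q⟩ hz
    simp only [m]
    rw [hβe, ← Complex.exp_add, add_neg_cancel_right, hbe u q hz]
  have hmc : Continuous m := by
    rw [continuous_iff_continuousAt]
    intro u
    have hmem : ∀ᶠ u' in 𝓝 u, (u', q u) ∈ Y :=
      (by fun_prop : Continuous fun u' : ℂ => (u', q u)).continuousAt.eventually_mem
        (hY.mem_nhds (hq u))
    have hc : ContinuousAt (fun z => h z * Complex.exp (-β z)) (u, q u) :=
      (hh.continuousAt (hY.mem_nhds (hq u))).mul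
        ((hβc.continuousAt (hY.mem_nhds (hq u))).neg.cexp)
    refine (hc.comp (f := fun u' : ℂ => (u', q u)) (by fun_prop)).congr ?_
    filter_upwards [hmem] with u' hu'
    simp only [Function.comp]
    rw [hm _ hu', mul_right_comm, ← Complex.exp_add, add_neg_cancel, Complex.exp_zero, one_mul]
  obtain ⟨M, hM, hMe⟩ := hX m hmc.continuousOn fun u _ => Complex.exp_ne_zero _
  refine ⟨fun z => β z + M z.1, hβc.add ((continuousOn_univ.mp hM).comp_continuousOn
    continuousOn_fst), fun z hz => ?_⟩
  rw [Complex.exp_add, hMe _ (mem_univ _), hm z hz]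

end ContinuousLogarithms

/-! ### Linear convexity and projections -/

section Hyperplane

open Topology

theorem IsSimplyConnected.hasContLog {X : Type*} [TopologicalSpace X] [LocallyPathConnectedSpace X]
    {S : Set X} (hS : IsSimplyConnected S) (hSo : IsOpen S) : HasContLog S := by
  intro h hh h0
  exact Complex.exists_continuousOn_eqOn_exp_comp hS hSo hh (by rintro ⟨x, hx, h⟩; exact h0 x hx h)

theorem hasContLog_univ : HasContLog (univ : Set ℂ) :=
  IsSimplyConnected.hasContLog (by
    have : ContractibleSpace (univ : Set ℂ) := (Homeomorph.Set.univ ℂ).contractibleSpace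
    exact (inferInstance : SimplyConnectedSpace (univ : Set ℂ))) isOpen_univ

theorem hasContLog_ball (r : ℝ) : HasContLog (Metric.ball (0 : ℂ) r) := by
  rcases le_or_gt r 0 with hr | hr
  · rw [Metric.ball_eq_empty.mpr hr]; exact fun h _ _ => ⟨0, by simp, by simp⟩
  · refine IsSimplyConnected.hasContLog ?_ Metric.isOpen_ball
    have := (convex_ball (0 : ℂ) r).contractibleSpace ⟨0, Metric.mem_ball_self hr⟩
    exact (inferInstance : SimplyConnectedSpace (Metric.ball (0 : ℂ) r))

theorem IsCConvex.lineLog {n : ℕ} {D : Set (EuclideanSpace ℂ (Fin n))} (hD : IsCConvex D)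
    (hDo : IsOpen D) : LineLog D := by
  intro p v
  set S : Set ℂ := {c : ℂ | p + c • v ∈ D} with hS
  rcases S.eq_empty_or_nonempty with he | hne
  · rw [he]
    exact ⟨isPreconnected_empty, fun h _ _ => ⟨0, by simp, by simp⟩⟩
  have hSo : IsOpen S := hDo.preimage (by fun_prop)
  by_cases hv : v = 0
  · obtain ⟨c, hc⟩ := hne
    have : S = univ := by
      ext c'
      simp only [hS, hv, smul_zero, mem_ofPred_eq] at hc ⊢
      exact iff_of_true hc (mem_univ _)
    rw [this]
    exact ⟨isPreconnected_univ, hasContLog_univ⟩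
  let L : AffineSubspace ℂ (EuclideanSpace ℂ (Fin n)) := AffineSubspace.mk' p (Submodule.span ℂ {v})
  have hemb : IsEmbedding fun c : ℂ => p + c • v := by
    have h1 : IsEmbedding (LinearMap.toSpanSingleton ℂ (EuclideanSpace ℂ (Fin n)) v) :=
      (LinearMap.isClosedEmbedding_of_injective
        (LinearMap.ker_toSpanSingleton ℂ hv)).isEmbedding
    exact (Homeomorph.addLeft p).isEmbedding.comp h1
  have himg : (fun c : ℂ => p + c • v) '' S = D ∩ (L : Set (EuclideanSpace ℂ (Fin n))) := by
    ext x
    constructor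
    · rintro ⟨c, hc, rfl⟩
      exact ⟨hc, by simp [L, AffineSubspace.mem_mk', Submodule.mem_span_singleton]⟩
    · rintro ⟨hx, hxL⟩
      obtain ⟨c, hc⟩ := Submodule.mem_span_singleton.mp (AffineSubspace.mem_mk'.mp hxL)
      have : p + c • v = x := by rw [hc]; simp
      exact ⟨c, by rw [hS, mem_ofPred_eq, this]; exact hx, this⟩
  have hcon : ContractibleSpace ↥(D ∩ (L : Set (EuclideanSpace ℂ (Fin n)))) := by
    refine hD L ?_ (himg ▸ hne.image _)
    have hdir : L.direction = Submodule.span ℂ {v} := AffineSubspace.direction_mk' _ _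
    rw [hdir]
    exact finrank_span_singleton hv
  have e := hemb.homeomorphImage S
  rw [himg] at e
  have hc : ContractibleSpace S := e.contractibleSpace
  exact ⟨isPreconnected_iff_preconnectedSpace.mpr inferInstance,
    IsSimplyConnected.hasContLog (inferInstance : SimplyConnectedSpace S) hSo⟩

/-- A continuous logarithm of u, restricted to the unit circle, would be t ↦ it + const, which is
not 2π-periodic. -/
theorem exists_exp_ne_self (N : ℂ → ℂ) (hN : ∀ u ≠ 0, ContinuousAt N u) :
    ∃ u ≠ 0, Complex.exp (N u) ≠ u := by
  by_contra! h
  have hne : ∀ t : ℝ, Complex.exp (t * Complex.I) ≠ 0 := fun t => Complex.exp_ne_zero _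
  have h1 : Continuous fun t : ℝ => N (Complex.exp (t * Complex.I)) := by
    rw [continuous_iff_continuousAt]
    intro t
    exact (hN _ (hne t)).comp (f := fun t : ℝ => Complex.exp (t * Complex.I)) (by fun_prop)
  have h2 := eqOn_of_exp_eqOn (S := univ) isPreconnected_univ h1.continuousOn
    (b₂ := fun t : ℝ => t * Complex.I + N 1) (by fun_prop)
    (fun t _ => by rw [h _ (hne t), Complex.exp_add, h 1 one_ne_zero, mul_one]) (mem_univ 0)
    (by simp)
  have h3 := h2 (mem_univ (2 * Real.pi))
  simp only [Complex.ofReal_mul, Complex.ofReal_ofNat, Complex.exp_two_pi_mul_I] at h3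
  have : (2 * Real.pi * Complex.I : ℂ) = 0 := by linear_combination -h3
  exact Complex.two_pi_I_ne_zero this

variable {E : Type*} [NormedAddCommGroup E] [NormedSpace ℂ E]

theorem LineLog.fibre {D : Set E} (hD : LineLog D) (V : Submodule ℂ E) (w : E) :
    LineLog {q : V × ℂ | (q.1 : E) + q.2 • w ∈ D} :=
  hD.preimage (V.subtype.coprod (LinearMap.toSpanSingleton ℂ E w))

/-- The coordinate transverse to `V` never vanishes on `D`, since `V` misses `D`. This gives its
logarithm over one affine chart of the pencil. -/
theorem LineLog.exists_log_coordinate {D : Set E} (hD : LineLog D) (hDo : IsOpen D)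
    (V : Submodule ℂ E) (hV : ∀ v ∈ V, v ∉ D) (e₁ e₂ : E)
    (hne : ∀ u : ℂ, ∃ q : V × ℂ, (q.1 : E) + q.2 • (e₁ + u • e₂) ∈ D) :
    ∃ b : ℂ × (V × ℂ) → ℂ,
      ContinuousOn b {z | (z.2.1 : E) + z.2.2 • (e₁ + z.1 • e₂) ∈ D} ∧
      ∀ z ∈ {z : ℂ × (V × ℂ) | (z.2.1 : E) + z.2.2 • (e₁ + z.1 • e₂) ∈ D},
        Complex.exp (b z) = z.2.2 := by
  have hfo : ∀ u : ℂ, IsOpen {q : V × ℂ | (q.1 : E) + q.2 • (e₁ + u • e₂) ∈ D} :=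
    fun u => hDo.preimage (by fun_prop)
  refine exists_log_family hasContLog_univ (F := V × ℂ)
    (Y := {z | (z.2.1 : E) + z.2.2 • (e₁ + z.1 • e₂) ∈ D}) (hDo.preimage (by fun_prop)) hne
    (fun u => (hD.fibre V (e₁ + u • e₂)).isPreconnected) (fun u => (hD.fibre V _).hasContLog (hfo u))
    (h := fun z => z.2.2) (by fun_prop) ?_
  rintro ⟨u, v, c⟩ hz rfl
  exact hV v v.2 (by simpa using hz)

/-- A pencil of subspaces whose axis misses `D` cannot consist only of subspaces meeting `D`. -/
theorem LineLog.false_of_pencil_meets {D : Set E} (hD : LineLog D) (hDo : IsOpen D)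
    (V : Submodule ℂ E) (hV : ∀ v ∈ V, v ∉ D) (e₁ e₂ : E)
    (h₁ : ∀ u : ℂ, ∃ q : V × ℂ, (q.1 : E) + q.2 • (e₁ + u • e₂) ∈ D)
    (h₂ : ∀ u : ℂ, ∃ q : V × ℂ, (q.1 : E) + q.2 • (e₂ + u • e₁) ∈ D) : False := by
  obtain ⟨b₁, hb₁, he₁⟩ := hD.exists_log_coordinate hDo V hV e₁ e₂ h₁
  obtain ⟨b₂, hb₂, he₂⟩ := hD.exists_log_coordinate hDo V hV e₂ e₁ h₂
  choose σ hσ using h₁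
  have htr : ∀ u : ℂ, u ≠ 0 → ∀ q : V × ℂ, (q.1 : E) + q.2 • (e₁ + u • e₂) ∈ D →
      (q.1 : E) + (q.2 * u) • (e₂ + u⁻¹ • e₁) ∈ D := by
    intro u hu q hq
    convert hq using 2
    rw [mul_smul, smul_add, smul_smul, mul_inv_cancel₀ hu, one_smul, add_comm]
  -- Over the overlap of the two charts the transverse coordinates differ by the factor `u`, so `N`
  -- is a logarithm of `u`.
  let N : ℂ × (V × ℂ) → ℂ := fun z => b₂ (z.1⁻¹, (z.2.1, z.2.2 * z.1)) - b₁ z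
  have hNc : ContinuousOn N ({z | (z.2.1 : E) + z.2.2 • (e₁ + z.1 • e₂) ∈ D} ∩ {z | z.1 ≠ 0}) := by
    refine (hb₂.comp (f := fun z : ℂ × (V × ℂ) => (z.1⁻¹, (z.2.1, z.2.2 * z.1))) ?_ ?_).sub
      (hb₁.mono inter_subset_left)
    · exact (continuousOn_fst.inv₀ fun z hz => hz.2).prodMk (by fun_prop)
    · rintro z ⟨hz, hz0⟩
      exact htr z.1 hz0 z.2 hz
  have hNo : IsOpen ({z : ℂ × (V × ℂ) | (z.2.1 : E) + z.2.2 • (e₁ + z.1 • e₂) ∈ D} ∩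
      {z | z.1 ≠ 0}) :=
    (hDo.preimage (by fun_prop)).inter (isOpen_ne.preimage continuous_fst)
  have hNe : ∀ u : ℂ, u ≠ 0 → ∀ q : V × ℂ, (q.1 : E) + q.2 • (e₁ + u • e₂) ∈ D →
      Complex.exp (N (u, q)) = u := by
    intro u hu q hq
    have hq0 : q.2 ≠ 0 := fun h => hV q.1 q.1.2 (by simpa [h] using hq)
    simp only [N]
    rw [Complex.exp_sub, he₂ _ (htr u hu q hq), he₁ _ hq]
    field_simp
  -- For fixed `u` the exponential of `N` is constant on a connected fibre, so `N` descends to a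
  -- function of `u` alone.
  have hNq : ∀ u : ℂ, u ≠ 0 → ∀ q : V × ℂ, (q.1 : E) + q.2 • (e₁ + u • e₂) ∈ D →
      N (u, q) = N (u, σ u) := by
    intro u hu q hq
    refine Complex.isCoveringMap_exp.isSeparatedMap.eqOn_of_comp_eqOn
      Complex.isCoveringMap_exp.isLocalHomeomorph.isLocallyInjective
      (hD.fibre V (e₁ + u • e₂)).isPreconnected (g₁ := fun q => N (u, q))
      (g₂ := fun _ => N (u, σ u)) ?_ continuousOn_const ?_ (hσ u) rfl hq
    · exact hNc.comp (f := fun q => (u, q)) (by fun_prop) fun q hq => ⟨hq, hu⟩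
    · exact fun q hq => Subtype.ext ((hNe u hu q hq).trans (hNe u hu _ (hσ u)).symm)
  obtain ⟨u, hu, hne⟩ := exists_exp_ne_self (fun u => N (u, σ u)) fun u hu => by
    have hc : ContinuousAt (fun u' => N (u', σ u)) u :=
      (hNc.continuousAt (hNo.mem_nhds ⟨hσ u, hu⟩)).comp
        (f := fun u' => (u', σ u)) (by fun_prop)
    have hm : ∀ᶠ u' in 𝓝 u, (u', σ u) ∈ ({z : ℂ × (V × ℂ) |
        (z.2.1 : E) + z.2.2 • (e₁ + z.1 • e₂) ∈ D} ∩ {z | z.1 ≠ 0}) :=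
      (by fun_prop : Continuous fun u' => (u', σ u)).continuousAt.eventually_mem
        (hNo.mem_nhds ⟨hσ u, hu⟩)
    refine hc.congr ?_
    filter_upwards [hm] with u' hu'
    exact hNq u' hu'.2 _ hu'.1
  exact hne (hNe u hu _ (hσ u))

/-- `ℂ`-convex open sets are linearly convex. -/
theorem LineLog.exists_hyperplane [FiniteDimensional ℂ E] {D : Set E} (hD : LineLog D)
    (hDo : IsOpen D) (hne : D.Nonempty) (h0 : (0 : E) ∉ D) :
    ∃ ℓ : E →ₗ[ℂ] ℂ, ∀ x ∈ D, ℓ x ≠ 0 := by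
  -- If no functional works, `f` vanishes at some `e₂ ∈ D`. Then `e₁`, `e₂` are independent modulo
  -- `V`, and maximality of `V` forces every member of the pencil they span to meet `D`.
  obtain ⟨V, hV⟩ := exists_maximal_of_wellFoundedGT
    (fun V : Submodule ℂ E => ∀ v ∈ V, v ∉ D) ⟨⊥, by simpa using h0⟩
  obtain ⟨e₁, he₁⟩ := hne
  obtain ⟨f, hf, hVf⟩ := Submodule.exists_le_ker_of_notMem (fun h => hV.prop e₁ h he₁ : e₁ ∉ V)
  by_contra! hcon
  obtain ⟨e₂, he₂, hfe⟩ := hcon f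
  have hmeet : ∀ w : E, w ∉ V → ∃ q : V × ℂ, (q.1 : E) + q.2 • w ∈ D := by
    intro w hw
    by_contra! hq
    have : V ⊔ Submodule.span ℂ {w} ≤ V := by
      refine hV.le_of_ge (y := V ⊔ Submodule.span ℂ {w}) ?_ le_sup_left
      intro x hx hxD
      obtain ⟨v, hv, y, hy, rfl⟩ := Submodule.mem_sup.mp hx
      obtain ⟨c, rfl⟩ := Submodule.mem_span_singleton.mp hy
      exact hq (⟨v, hv⟩, c) hxD
    exact hw (this (Submodule.mem_sup_right (Submodule.mem_span_singleton_self w)))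
  have hfV : ∀ v ∈ V, f v = 0 := fun v hv => LinearMap.mem_ker.mp (hVf hv)
  refine hD.false_of_pencil_meets hDo V hV.prop e₁ e₂ (fun u => hmeet _ fun h => ?_)
    (fun u => hmeet _ fun h => ?_)
  · have := hfV _ h
    simp [hfe, hf] at this
  · have h1 := hfV _ h
    simp only [map_add, hfe, map_smul, smul_eq_mul, zero_add, mul_eq_zero, hf, or_false] at h1
    rw [h1, zero_smul, add_zero] at h
    exact hV.prop e₂ h he₂

theorem LineLog.isPreconnected_level {D : Set E} (hD : LineLog D) (ℓ : E →ₗ[ℂ] ℂ) (c : ℂ) :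
    IsPreconnected {x | x ∈ D ∧ ℓ x = c} := by
  refine isPreconnected_of_forall_pair fun x hx y hy => ?_
  refine ⟨(fun c : ℂ => x + c • (y - x)) '' {c | x + c • (y - x) ∈ D}, ?_, ?_, ?_, ?_⟩
  · rintro _ ⟨t, ht, rfl⟩
    exact ⟨ht, by simp [hx.2, hy.2]⟩
  · exact ⟨0, by simpa using hx.1, by simp⟩
  · exact ⟨1, by simpa using hy.1, by simp⟩
  · exact (hD x (y - x)).1.image _ (by fun_prop)

/-- Pull `h` back to `D` and take a logarithm there. It is constant on the connected level sets of
`ℓ`, hence descends; continuity of the descended function uses that `ℓ` is open. -/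
theorem LineLog.hasContLog_image {D : Set E} (hD : LineLog D) (hDo : IsOpen D)
    (ℓ : E →L[ℂ] ℂ) (hℓ : IsOpenMap ℓ) : HasContLog (ℓ '' D) := by
  intro h hh h0
  obtain ⟨b, hb, he⟩ := hD.hasContLog hDo (fun x => h (ℓ x))
    (hh.comp ℓ.continuous.continuousOn (mapsTo_image ℓ D)) fun x hx => h0 _ (mem_image_of_mem ℓ hx)
  have hfib : ∀ x ∈ D, ∀ y ∈ D, ℓ x = ℓ y → b x = b y := by
    intro x hx y hy hxy
    refine eqOn_of_exp_eqOn (hD.isPreconnected_level ℓ (ℓ y)) (hb.mono fun x hx => hx.1)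
      (b₂ := fun _ => b y) continuousOn_const (fun z hz => ?_) ⟨hy, rfl⟩ rfl ⟨hx, hxy⟩
    have hz2 : ℓ z = ℓ y := hz.2
    rw [he z hz.1, he y hy, hz2]
  classical
  let s : ℂ → E := Function.invFunOn ℓ D
  have hs : ∀ z ∈ ℓ '' D, s z ∈ D ∧ ℓ (s z) = z := fun z hz =>
    ⟨Function.invFunOn_mem hz, Function.invFunOn_eq hz⟩
  refine ⟨fun z => b (s z), ?_, fun z hz => ?_⟩
  · intro z hz
    refine ContinuousAt.continuousWithinAt ?_
    have hbz := hb.continuousAt (hDo.mem_nhds (hs z hz).1)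
    intro U hU
    have h1 := hℓ.image_mem_nhds (Filter.inter_mem (hbz hU) (hDo.mem_nhds (hs z hz).1))
    rw [(hs z hz).2] at h1
    refine Filter.mem_map.mpr (Filter.mem_of_superset h1 ?_)
    rintro _ ⟨x, ⟨hxU, hxD⟩, rfl⟩
    have := hs _ (mem_image_of_mem ℓ hxD)
    simp only [mem_preimage] at hxU ⊢
    rwa [hfib _ this.1 x hxD this.2]
  · rw [he _ (hs z hz).1, (hs z hz).2]

end Hyperplane

/-! ### Mean value inequality -/

section MeanValue

open Topology

theorem enorm_two_pi_mul_le_lintegral_circle {f : ℂ → ℂ}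
    (hf : DiffContOnCl ℂ f (Metric.ball 0 1)) :
    ENNReal.ofReal (2 * Real.pi) * ‖f 0‖ₑ
      ≤ ∫⁻ θ in Ioc 0 (2 * Real.pi), ‖f (circleMap 0 1 θ)‖ₑ := by
  have h1 : Real.circleAverage f 0 1 = f 0 := DiffContOnCl.circleAverage (by simpa using hf)
  rw [Real.circleAverage_def, intervalIntegral.integral_of_le Real.two_pi_pos.le,
    inv_smul_eq_iff₀ Real.two_pi_pos.ne'] at h1
  have h2 := enorm_integral_le_lintegral_enorm (μ := volume.restrict (Ioc 0 (2 * Real.pi)))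
    fun θ => f (circleMap 0 1 θ)
  rw [h1, enorm_smul, Real.enorm_of_nonneg Real.two_pi_pos.le] at h2
  exact h2

/-- The mean value inequality for a rotation invariant weight. -/
theorem enorm_zero_mul_lintegral_le {E : Type*} [NormedAddCommGroup E] [NormedSpace ℂ E]
    [MeasurableSpace E] [BorelSpace E] [SecondCountableTopology E] {μ : Measure E} [SFinite μ]
    (hμ : ∀ θ : ℝ, MeasurePreserving (fun x : E => circleMap 0 1 θ • x) μ μ)
    {U : Set E} (hU : IsOpen U) (hbal : ∀ x ∈ U, ∀ c : ℂ, ‖c‖ ≤ 1 → c • x ∈ U)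
    {ψ : E → ℂ} (hψ : DifferentiableOn ℂ ψ U) {k : E → ℝ≥0∞} (hk : Measurable k)
    (hkθ : ∀ (θ : ℝ) (x : E), k (circleMap 0 1 θ • x) = k x) (hkU : ∀ x, x ∉ U → k x = 0) :
    ‖ψ 0‖ₑ * ∫⁻ x, k x ∂μ ≤ ∫⁻ x, ‖ψ x‖ₑ * k x ∂μ := by
  classical
  have hpi : ENNReal.ofReal (2 * Real.pi) ≠ 0 := by simp [Real.pi_pos]
  set G : E → ℝ≥0∞ := fun x => ‖U.piecewise ψ 0 x‖ₑ with hG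
  have hGm : Measurable G :=
    (hψ.continuousOn.measurable_piecewise continuousOn_const hU.measurableSet).enorm
  have hGk : ∀ x, ‖ψ x‖ₑ * k x = G x * k x := by
    intro x
    by_cases hx : x ∈ U
    · simp [hG, hx]
    · simp [hkU x hx]
  simp only [hGk]
  have hrot : ∀ θ : ℝ, ∫⁻ x, G x * k x ∂μ = ∫⁻ x, G (circleMap 0 1 θ • x) * k x ∂μ := by
    intro θ
    have h1 := (hμ θ).lintegral_comp (hGm.mul hk)
    simp only [Pi.mul_apply, hkθ] at h1
    exact h1.symm
  have hmeas : Measurable fun p : ℝ × E => G (circleMap 0 1 p.1 • p.2) * k p.2 := by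
    refine (hGm.comp ?_).mul (hk.comp measurable_snd)
    exact Continuous.measurable (by fun_prop)
  have hswap : ENNReal.ofReal (2 * Real.pi) * ∫⁻ x, G x * k x ∂μ =
      ∫⁻ x, ∫⁻ θ in Ioc 0 (2 * Real.pi), G (circleMap 0 1 θ • x) * k x ∂volume ∂μ := by
    rw [← lintegral_lintegral_swap (μ := volume.restrict (Ioc 0 (2 * Real.pi)))
      (f := fun θ x => G (circleMap 0 1 θ • x) * k x) hmeas.aemeasurable]
    simp only [← hrot]
    rw [lintegral_const, Measure.restrict_apply_univ, Real.volume_Ioc, sub_zero, mul_comm]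
  rw [← ENNReal.mul_le_mul_iff_right hpi ENNReal.ofReal_ne_top, hswap, ← mul_assoc,
    ← lintegral_const_mul _ hk]
  refine lintegral_mono fun x => ?_
  by_cases hx : x ∈ U
  · have hcl : DiffContOnCl ℂ (fun c : ℂ => ψ (c • x)) (Metric.ball 0 1) := by
      refine DifferentiableOn.diffContOnCl (hψ.comp (by fun_prop) fun c hc => hbal x hx c ?_)
      rw [closure_ball _ one_ne_zero] at hc
      simpa using hc
    have h1 := enorm_two_pi_mul_le_lintegral_circle hcl
    rw [zero_smul] at h1
    have hm : Measurable fun θ : ℝ => G (circleMap 0 1 θ • x) :=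
      hGm.comp (Continuous.measurable (by fun_prop))
    rw [lintegral_mul_const _ hm]
    refine mul_le_mul_left (h1.trans_eq ?_) _
    refine lintegral_congr fun θ => ?_
    simp [hG, hbal x hx (circleMap 0 1 θ) (by simp)]
  · simp [hkU x hx]

theorem measurePreserving_circleMap_smul {E : Type*} [NormedAddCommGroup E] [NormedSpace ℂ E]
    [InnerProductSpace ℝ E] [IsScalarTower ℝ ℂ E] [FiniteDimensional ℝ E]
    [MeasurableSpace E] [BorelSpace E] (θ : ℝ) :
    MeasurePreserving (fun x : E => circleMap 0 1 θ • x) volume volume := by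
  have h1 : circleMap 0 1 θ ≠ 0 := by simp [circleMap]
  let e : E ≃ₗᵢ[ℝ] E :=
    { (LinearEquiv.smulOfNeZero ℂ E (circleMap 0 1 θ) h1).restrictScalars ℝ with
      norm_map' := fun x => by
        change ‖circleMap 0 1 θ • x‖ = ‖x‖
        simp [norm_smul] }
  exact e.measurePreserving

end MeanValue

/-! ### Logarithmic area and Bieberbach's inequality -/

section Area

open Topology

theorem det_smul_one_complex (c : ℂ) : (c • (1 : ℂ →L[ℝ] ℂ)).det = ‖c‖ ^ 2 := by
  have h : ((c • (1 : ℂ →L[ℝ] ℂ) : ℂ →L[ℝ] ℂ) : ℂ →ₗ[ℝ] ℂ) = Algebra.lmul ℝ ℂ c := by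
    ext
    simp
  rw [ContinuousLinearMap.det, h, ← Complex.normSq_eq_norm_sq, ← Algebra.norm_complex_apply]
  rfl

theorem lintegral_image_holomorphic {S : Set ℂ} (hS : MeasurableSet S) {f f' : ℂ → ℂ}
    (hf : ∀ x ∈ S, HasDerivAt f (f' x) x) (hinj : InjOn f S) (g : ℂ → ℝ≥0∞) :
    ∫⁻ w in f '' S, g w = ∫⁻ x in S, ENNReal.ofReal (‖f' x‖ ^ 2) * g (f x) := by
  rw [lintegral_image_eq_lintegral_abs_det_fderiv_mul volume hS
    (fun x hx => (hf x hx).complexToReal_fderiv.hasFDerivWithinAt) hinj g]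
  simp only [det_smul_one_complex, abs_pow, abs_norm]

theorem measurableSet_image_holomorphic {S : Set ℂ} (hS : MeasurableSet S) {f f' : ℂ → ℂ}
    (hf : ∀ x ∈ S, HasDerivAt f (f' x) x) (hinj : InjOn f S) : MeasurableSet (f '' S) :=
  measurable_image_of_fderivWithin hS
    (fun x hx => (hf x hx).complexToReal_fderiv.hasFDerivWithinAt) hinj

/-- The density of the flat metric `|dw|² / |w|²` on the punctured plane. -/
noncomputable def logDensity (w : ℂ) : ℝ≥0∞ := ENNReal.ofReal (‖w‖ ^ 2)⁻¹

theorem measurable_logDensity : Measurable logDensity := by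
  unfold logDensity; fun_prop

/-- Inversion is an isometry of |dw|²/|w|². -/
theorem lintegral_logDensity_inv {S : Set ℂ} (hS : MeasurableSet S) (h0 : (0 : ℂ) ∉ S) :
    ∫⁻ w in (·⁻¹) '' S, logDensity w = ∫⁻ w in S, logDensity w := by
  have hne : ∀ x ∈ S, x ≠ 0 := fun x hx h => h0 (h ▸ hx)
  rw [lintegral_image_holomorphic hS (f' := fun x => -(x ^ 2)⁻¹)
    (fun x hx => hasDerivAt_inv (hne x hx)) (inv_injective.injOn)]
  refine setLIntegral_congr_fun hS fun x hx => ?_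
  have : ‖x‖ ≠ 0 := norm_ne_zero_iff.mpr (hne x hx)
  simp only [logDensity]
  rw [← ENNReal.ofReal_mul (by positivity)]
  congr 1
  simp only [norm_neg, norm_inv, norm_pow]
  field_simp

/-- The collar ε < |w| < cε has positive area. The remaining area must be finite for the inequality
to be strict. -/
theorem lintegral_logDensity_lt {ε c : ℝ} (hε : 0 < ε) (hc : 1 < c) (hcε : c * ε < 1) :
    ∫⁻ w in {w : ℂ | c * ε ≤ ‖w‖ ∧ ‖w‖ ≤ 1}, logDensity w
      < ∫⁻ w in {w : ℂ | ε < ‖w‖ ∧ ‖w‖ < 1}, logDensity w := by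
  have hεc : ε < c * ε := by nlinarith
  have hm : ∀ a b : ℝ, MeasurableSet {w : ℂ | a < ‖w‖ ∧ ‖w‖ < b} := fun a b =>
    ((isOpen_lt continuous_const continuous_norm).inter
      (isOpen_lt continuous_norm continuous_const)).measurableSet
  have hm2 : MeasurableSet {w : ℂ | c * ε ≤ ‖w‖ ∧ ‖w‖ < 1} :=
    (isClosed_le continuous_const continuous_norm).measurableSet.inter
      (isOpen_lt continuous_norm continuous_const).measurableSet
  have h1 : ∫⁻ w in {w : ℂ | c * ε ≤ ‖w‖ ∧ ‖w‖ ≤ 1}, logDensity w =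
      ∫⁻ w in {w : ℂ | c * ε ≤ ‖w‖ ∧ ‖w‖ < 1}, logDensity w := by
    refine setLIntegral_congr ?_
    have : ∀ᵐ w : ℂ, w ∉ Metric.sphere (0 : ℂ) 1 :=
      measure_eq_zero_iff_ae_notMem.mp (Measure.addHaar_sphere volume 0 1)
    filter_upwards [this] with w hw
    have hw' : ‖w‖ ≠ 1 := by simpa using hw
    refine propext ⟨fun h => ⟨h.1, lt_of_le_of_ne h.2 hw'⟩, fun h => ⟨h.1, h.2.le⟩⟩
  have hsub : {w : ℂ | ε < ‖w‖ ∧ ‖w‖ < c * ε} ∪ {w : ℂ | c * ε ≤ ‖w‖ ∧ ‖w‖ < 1} ⊆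
      {w : ℂ | ε < ‖w‖ ∧ ‖w‖ < 1} := by
    rintro w (⟨h1, h2⟩ | ⟨h1, h2⟩)
    · exact ⟨h1, h2.trans hcε⟩
    · exact ⟨hεc.trans_le h1, h2⟩
  have hdisj : Disjoint {w : ℂ | ε < ‖w‖ ∧ ‖w‖ < c * ε} {w : ℂ | c * ε ≤ ‖w‖ ∧ ‖w‖ < 1} :=
    Set.disjoint_left.mpr fun w h1 h2 => not_lt.mpr h2.1 h1.2
  have hfin : ∫⁻ w in {w : ℂ | c * ε ≤ ‖w‖ ∧ ‖w‖ < 1}, logDensity w ≠ ⊤ := by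
    have hle : ∫⁻ w in {w : ℂ | c * ε ≤ ‖w‖ ∧ ‖w‖ < 1}, logDensity w ≤
        ∫⁻ w in {w : ℂ | c * ε ≤ ‖w‖ ∧ ‖w‖ < 1}, ENNReal.ofReal ((c * ε) ^ 2)⁻¹ := by
      refine setLIntegral_mono measurable_const fun w hw => ENNReal.ofReal_le_ofReal ?_
      have : 0 < c * ε := hε.trans hεc
      have := hw.1
      gcongr
    refine ne_top_of_le_ne_top ?_ hle
    rw [setLIntegral_const]
    refine ENNReal.mul_ne_top ENNReal.ofReal_ne_top (ne_top_of_le_ne_top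
      (measure_ball_lt_top (μ := volume) (x := (0 : ℂ)) (r := 1)).ne (measure_mono fun w hw => ?_))
    simpa using hw.2
  have hpos : 0 < ∫⁻ w in {w : ℂ | ε < ‖w‖ ∧ ‖w‖ < c * ε}, logDensity w := by
    rw [setLIntegral_pos_iff measurable_logDensity]
    have hsupp : {w : ℂ | ε < ‖w‖ ∧ ‖w‖ < c * ε} ⊆ Function.support logDensity := by
      intro w hw
      have : 0 < ‖w‖ := hε.trans hw.1
      simp only [Function.mem_support, logDensity, ne_eq, ENNReal.ofReal_eq_zero, not_le]
      positivity
    rw [inter_eq_right.mpr hsupp]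
    refine IsOpen.measure_pos volume ((isOpen_lt continuous_const continuous_norm).inter
      (isOpen_lt continuous_norm continuous_const)) ⟨((ε + c * ε) / 2 : ℝ), ?_⟩
    simp only [mem_ofPred_eq, Complex.norm_real, Real.norm_eq_abs]
    rw [abs_of_pos (by linarith)]
    constructor <;> linarith
  rw [h1]
  refine lt_of_lt_of_le ?_ (lintegral_mono_set hsub)
  rw [lintegral_union hm2 hdisj]
  simpa using ENNReal.add_lt_add_right hfin hpos

theorem hasStrictDerivAt_of_isOpen {f : ℂ → ℂ} {U : Set ℂ}
    (hf : DifferentiableOn ℂ f U) (hU : IsOpen U) {x : ℂ} (hx : x ∈ U) :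
    HasStrictDerivAt f (deriv f x) x :=
  (hf.analyticAt (hU.mem_nhds hx)).hasStrictDerivAt

/-- The local inverse has derivative of modulus 1/|d| < 1/c at 0, so near 0 it shrinks norms to at
most 1/c times their size. -/
theorem exists_ball_subset_image {φ : ℂ → ℂ} {d : ℂ} (hφ : HasStrictDerivAt φ d 0)
    (h0 : φ 0 = 0) {c : ℝ} (hc : 0 < c) (hcd : c < ‖d‖) :
    ∀ᶠ ε : ℝ in 𝓝[>] 0, Metric.ball 0 (c * ε) ⊆ φ '' Metric.ball 0 ε := by
  have hd : d ≠ 0 := norm_ne_zero_iff.mp (hc.trans hcd).ne'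
  set g := HasStrictDerivAt.localInverse φ d 0 hφ hd
  have hg : HasStrictDerivAt g d⁻¹ 0 := by
    have := hφ.to_localInverse hd
    rwa [h0] at this
  have hg0 : g 0 = 0 := by
    have := HasStrictFDerivAt.localInverse_apply_image
      (hφ.hasStrictFDerivAt_equiv hd)
    rwa [h0] at this
  have hright : ∀ᶠ w in 𝓝 (0 : ℂ), φ (g w) = w := by
    have := HasStrictFDerivAt.eventually_right_inverse
      (hφ.hasStrictFDerivAt_equiv hd)
    rwa [h0] at this
  have hbound : ∀ᶠ w in 𝓝 (0 : ℂ), ‖g w‖ ≤ c⁻¹ * ‖w‖ := by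
    have h1 := hg.hasDerivAt.isLittleO
    have hpos : 0 < c⁻¹ - ‖d‖⁻¹ := sub_pos.mpr (inv_strictAnti₀ hc hcd)
    filter_upwards [h1.def hpos] with w hw
    simp only [hg0, sub_zero, smul_eq_mul] at hw
    have h2 : ‖g w‖ ≤ ‖g w - w * d⁻¹‖ + ‖w * d⁻¹‖ := by
      simpa using norm_add_le (g w - w * d⁻¹) (w * d⁻¹)
    rw [norm_mul, norm_inv] at h2
    nlinarith
  obtain ⟨r, hr, hrs⟩ := Metric.eventually_nhds_iff_ball.mp (hright.and hbound)
  have : ∀ᶠ ε : ℝ in 𝓝[>] 0, c * ε < r := by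
    have : ContinuousAt (fun ε : ℝ => c * ε) 0 := by fun_prop
    exact (this.eventually_lt continuousAt_const (by simpa using hr)).filter_mono
      nhdsWithin_le_nhds
  filter_upwards [this] with ε hε w hw
  obtain ⟨h1, h2⟩ := hrs w (Metric.ball_subset_ball hε.le hw)
  refine ⟨g w, ?_, h1⟩
  rw [mem_ball_zero_iff] at hw ⊢
  calc ‖g w‖ ≤ c⁻¹ * ‖w‖ := h2
    _ < c⁻¹ * (c * ε) := by gcongr
    _ = ε := by field_simp

/-- The logarithmic area of the image of an annulus under an injective holomorphic map fixing
the origin is at least that of the annulus. -/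
theorem lintegral_logDensity_image_ge {φ : ℂ → ℂ} (hφ : DifferentiableOn ℂ φ (Metric.ball 0 1))
    (hinj : InjOn φ (Metric.ball 0 1)) (h0 : φ 0 = 0) (hd : deriv φ 0 ≠ 0) {ε : ℝ} (hε : 0 < ε) :
    ∫⁻ w in {w : ℂ | ε < ‖w‖ ∧ ‖w‖ < 1}, logDensity w
      ≤ ∫⁻ w in φ '' {w : ℂ | ε < ‖w‖ ∧ ‖w‖ < 1}, logDensity w := by
  set A : Set ℂ := {w : ℂ | ε < ‖w‖ ∧ ‖w‖ < 1} with hA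
  have hAm : MeasurableSet A :=
    ((isOpen_lt continuous_const continuous_norm).inter
      (isOpen_lt continuous_norm continuous_const)).measurableSet
  have hAB : A ⊆ Metric.ball 0 1 := fun x hx => by simpa using hx.2
  have hdiff : ∀ x ∈ Metric.ball (0 : ℂ) 1, HasDerivAt φ (deriv φ x) x := fun x hx =>
    (hφ.differentiableAt (Metric.isOpen_ball.mem_nhds hx)).hasDerivAt
  rw [lintegral_image_holomorphic hAm (fun x hx => hdiff x (hAB hx)) (hinj.mono hAB)]
  have h0B : (0 : ℂ) ∈ Metric.ball (0 : ℂ) 1 := by simp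
  set q := dslope φ 0 with hq
  have hqd : DifferentiableOn ℂ q (Metric.ball 0 1) :=
    (Complex.differentiableOn_dslope (Metric.isOpen_ball.mem_nhds h0B)).mpr hφ
  have hqx : ∀ x : ℂ, x ≠ 0 → q x = φ x / x := fun x hx => by
    rw [hq, dslope_of_ne _ hx, slope_def_field, h0, sub_zero, sub_zero]
  have hφne : ∀ x ∈ Metric.ball (0 : ℂ) 1, x ≠ 0 → φ x ≠ 0 := fun x hx hx0 h =>
    hx0 (hinj hx h0B (h.trans h0.symm))
  have hqne : ∀ x ∈ Metric.ball (0 : ℂ) 1, q x ≠ 0 := by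
    intro x hx
    by_cases hx0 : x = 0
    · rw [hx0, hq, dslope_same]; exact hd
    · rw [hqx x hx0]; exact div_ne_zero (hφne x hx hx0) hx0
  -- The pulled-back area density is |φ'/φ|² = |ψ|/|x|² for ψ = (xφ'/φ)². This ψ is holomorphic with
  -- ψ(0) = 1, so the mean value inequality with weight |x|⁻² on the annulus applies.
  have hψ : DifferentiableOn ℂ (fun x => (deriv φ x / q x) ^ 2) (Metric.ball 0 1) :=
    ((hφ.deriv Metric.isOpen_ball).div hqd hqne).pow 2
  have hmean := enorm_zero_mul_lintegral_le (μ := (volume : Measure ℂ))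
    measurePreserving_circleMap_smul Metric.isOpen_ball
    (fun x hx c hc => by
      rw [mem_ball_zero_iff] at hx ⊢
      rw [norm_smul]
      exact lt_of_le_of_lt (mul_le_of_le_one_left (norm_nonneg _) hc) hx)
    hψ (k := A.indicator logDensity) (measurable_logDensity.indicator hAm)
    (fun θ x => by simp [Set.indicator, hA, logDensity])
    (fun x hx => indicator_of_notMem (fun h => hx (hAB h)) _)
  have hψ0 : (deriv φ 0 / q 0) ^ 2 = 1 := by rw [hq, dslope_same, div_self hd, one_pow]
  rw [hψ0, enorm_one, one_mul, lintegral_indicator hAm] at hmean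
  refine hmean.trans_eq ?_
  rw [← lintegral_indicator hAm]
  refine lintegral_congr fun x => ?_
  by_cases hx : x ∈ A
  · have hx0 : x ≠ 0 := by
      rintro rfl
      have := hx.1
      rw [norm_zero] at this
      linarith
    have h1 := hφne x (hAB hx) hx0
    have hn1 : ‖φ x‖ ≠ 0 := norm_ne_zero_iff.mpr h1
    have hn2 : ‖x‖ ≠ 0 := norm_ne_zero_iff.mpr hx0
    rw [indicator_of_mem hx, indicator_of_mem hx, hqx x hx0, logDensity, logDensity,
      ← ofReal_norm, ← ENNReal.ofReal_mul (by positivity), ← ENNReal.ofReal_mul (by positivity)]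
    congr 1
    simp only [norm_pow, norm_div]
    field_simp
  · simp [indicator_of_notMem hx]

/-- Bieberbach's inequality for injective Bieberbach–Eilenberg functions. -/
theorem norm_deriv_le_one_of_mul_ne_one {φ : ℂ → ℂ} (hφ : DifferentiableOn ℂ φ (Metric.ball 0 1))
    (hinj : InjOn φ (Metric.ball 0 1)) (h0 : φ 0 = 0)
    (hmul : ∀ x ∈ Metric.ball (0 : ℂ) 1, ∀ y ∈ Metric.ball (0 : ℂ) 1, φ x * φ y ≠ 1) :
    ‖deriv φ 0‖ ≤ 1 := by
  by_contra! hlt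
  obtain ⟨c, hc, hcd⟩ := exists_between hlt
  have h0B : (0 : ℂ) ∈ Metric.ball (0 : ℂ) 1 := by simp
  have hd : deriv φ 0 ≠ 0 := norm_ne_zero_iff.mp (zero_lt_one.trans hlt).ne'
  have hc0 : 0 < c := zero_lt_one.trans hc
  have hev : ∀ᶠ ε : ℝ in 𝓝[>] 0, c * ε < 1 := by
    have : ContinuousAt (fun ε : ℝ => c * ε) 0 := by fun_prop
    exact (this.eventually_lt continuousAt_const (by simp)).filter_mono
      nhdsWithin_le_nhds
  -- For this ε the image of the ε-disc covers the cε-disc. By injectivity the image of the annulus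
  -- avoids the cε-disc, and by `hmul` so do the inverses of its points.
  obtain ⟨ε, hsub, hcε, hε⟩ := ((exists_ball_subset_image
    (hasStrictDerivAt_of_isOpen hφ Metric.isOpen_ball h0B) h0 hc0 hcd).and
    (hev.and self_mem_nhdsWithin)).exists
  have hε : 0 < ε := hε
  set A : Set ℂ := {w : ℂ | ε < ‖w‖ ∧ ‖w‖ < 1} with hA
  have hAm : MeasurableSet A :=
    ((isOpen_lt continuous_const continuous_norm).inter
      (isOpen_lt continuous_norm continuous_const)).measurableSet
  have hAB : A ⊆ Metric.ball 0 1 := fun x hx => by simpa using hx.2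
  have hdiff : ∀ x ∈ Metric.ball (0 : ℂ) 1, HasDerivAt φ (deriv φ x) x := fun x hx =>
    (hφ.differentiableAt (Metric.isOpen_ball.mem_nhds hx)).hasDerivAt
  have hPm : MeasurableSet (φ '' A) :=
    measurableSet_image_holomorphic hAm (fun x hx => hdiff x (hAB hx)) (hinj.mono hAB)
  have hsmall : Metric.ball (0 : ℂ) ε ⊆ Metric.ball 0 1 :=
    Metric.ball_subset_ball (by nlinarith)
  have hlow : ∀ x ∈ A, c * ε ≤ ‖φ x‖ := by
    intro x hx
    by_contra! h
    obtain ⟨y, hy, hyx⟩ := hsub (mem_ball_zero_iff.mpr h)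
    have := hinj (hsmall hy) (hAB hx) hyx
    rw [this, mem_ball_zero_iff] at hy
    exact absurd hy (not_lt.mpr hx.1.le)
  have hcε0 : 0 < c * ε := by positivity
  have hlow' : ∀ x ∈ A, c * ε ≤ ‖(φ x)⁻¹‖ := by
    intro x hx
    by_contra! h
    obtain ⟨y, hy, hyx⟩ := hsub (mem_ball_zero_iff.mpr h)
    have hne : φ x ≠ 0 := norm_pos_iff.mp (hcε0.trans_le (hlow x hx))
    exact hmul x (hAB hx) y (hsmall hy) (by rw [hyx, mul_inv_cancel₀ hne])
  set P₂ : Set ℂ := φ '' A ∩ {w | 1 ≤ ‖w‖} with hP₂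
  have hNm : MeasurableSet {w : ℂ | 1 ≤ ‖w‖} :=
    (isClosed_le continuous_const continuous_norm).measurableSet
  have hP₂m : MeasurableSet P₂ := hPm.inter hNm
  have hzero : (0 : ℂ) ∉ P₂ := by
    rintro ⟨-, h⟩
    simp only [mem_ofPred_eq, norm_zero] at h
    linarith
  have hI₂m : MeasurableSet ((·⁻¹) '' P₂ : Set ℂ) := by
    rw [Set.image_inv_eq_inv]; exact hP₂m.inv
  have hdisj : Disjoint (φ '' A \ {w | 1 ≤ ‖w‖}) ((·⁻¹) '' P₂ : Set ℂ) := by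
    refine Set.disjoint_left.mpr ?_
    rintro _ ⟨⟨x, hx, rfl⟩, -⟩ ⟨_, ⟨⟨y, hy, rfl⟩, h1⟩, hxy⟩
    have hne : φ y ≠ 0 := norm_pos_iff.mp (hcε0.trans_le (hlow y hy))
    refine hmul x (hAB hx) y (hAB hy) ?_
    simp only at hxy
    rw [← hxy, inv_mul_cancel₀ hne]
  -- Inverting the part outside the unit disc preserves its area. By `hmul` the result is disjoint
  -- from the part inside, so everything fits into cε ≤ |w| ≤ 1, whose area is too small.
  have hfold : ∫⁻ w in φ '' A, logDensity w ≤
      ∫⁻ w in {w : ℂ | c * ε ≤ ‖w‖ ∧ ‖w‖ ≤ 1}, logDensity w := by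
    rw [← lintegral_inter_add_sdiff logDensity (φ '' A) hNm, ← hP₂,
      ← lintegral_logDensity_inv hP₂m hzero, add_comm, ← lintegral_union hI₂m hdisj]
    refine lintegral_mono_set ?_
    rintro _ (⟨⟨x, hx, rfl⟩, h⟩ | ⟨_, ⟨⟨x, hx, rfl⟩, h⟩, rfl⟩)
    · exact ⟨hlow x hx, (not_le.mp h).le⟩
    · refine ⟨hlow' x hx, ?_⟩
      rw [norm_inv]
      exact inv_le_one_of_one_le₀ h
  exact absurd ((lintegral_logDensity_image_ge hφ hinj h0 hd hε).trans hfold)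
    (not_le.mpr (lintegral_logDensity_lt hε hc hcε))

end Area

/-! ### Koebe's theorem and its integrated form -/

section Koebe

open Topology ComplexConjugate

/-- Near x a continuous logarithm equals its value at x plus the principal logarithm of h/h(x),
because its increments are smaller than π. -/
theorem HasContLog.exists_differentiableOn {E : Type*} [NormedAddCommGroup E] [NormedSpace ℂ E]
    {D : Set E} (hD : HasContLog D) (hDo : IsOpen D) {h : E → ℂ} (hh : DifferentiableOn ℂ h D)
    (h0 : ∀ x ∈ D, h x ≠ 0) :
    ∃ b : E → ℂ, DifferentiableOn ℂ b D ∧ ∀ x ∈ D, Complex.exp (b x) = h x := by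
  obtain ⟨b, hb, he⟩ := hD h hh.continuousOn h0
  refine ⟨b, fun x hx => DifferentiableAt.differentiableWithinAt ?_, he⟩
  have hhx : DifferentiableAt ℂ h x := hh.differentiableAt (hDo.mem_nhds hx)
  have h1 : DifferentiableAt ℂ (fun y => b x + Complex.log (h y * (h x)⁻¹)) x :=
    ((hhx.mul_const (h x)⁻¹).clog (by simp [h0 x hx])).const_add _
  refine h1.congr_of_eventuallyEq ?_
  have hbx : ContinuousAt (fun y => b y - b x) x :=
    (hb.continuousAt (hDo.mem_nhds hx)).sub continuousAt_const
  have hnear : ∀ᶠ y in 𝓝 x, b y - b x ∈ Metric.ball (0 : ℂ) Real.pi :=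
    hbx.eventually_mem (by simpa using Metric.ball_mem_nhds (0 : ℂ) Real.pi_pos)
  filter_upwards [hnear, hDo.mem_nhds hx] with y hy hyD
  rw [mem_ball_zero_iff] at hy
  have him := abs_lt.mp ((Complex.abs_im_le_norm _).trans_lt hy)
  rw [← div_eq_mul_inv, ← he y hyD, ← he x hx, ← Complex.exp_sub, Complex.log_exp him.1 him.2.le]
  ring

/-- The Koebe one-quarter theorem, for nonvanishing injective functions on the disc. -/
theorem norm_deriv_zero_le_of_injOn {F : ℂ → ℂ} (hF : DifferentiableOn ℂ F (Metric.ball 0 1))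
    (hinj : InjOn F (Metric.ball 0 1)) (hne : ∀ x ∈ Metric.ball (0 : ℂ) 1, F x ≠ 0) :
    ‖deriv F 0‖ ≤ 4 * ‖F 0‖ := by
  have h0B : (0 : ℂ) ∈ Metric.ball (0 : ℂ) 1 := by simp
  obtain ⟨L, hL, hLe⟩ := (hasContLog_ball 1).exists_differentiableOn Metric.isOpen_ball hF hne
  set G : ℂ → ℂ := fun x => Complex.exp (L x / 2) with hG
  have hGd : DifferentiableOn ℂ G (Metric.ball 0 1) := (hL.div_const 2).cexp
  have hG2 : ∀ x ∈ Metric.ball (0 : ℂ) 1, G x * G x = F x := by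
    intro x hx
    rw [hG, ← Complex.exp_add, add_halves, hLe x hx]
  have hG0 : ∀ x, G x ≠ 0 := fun x => Complex.exp_ne_zero _
  have hneg : ∀ x ∈ Metric.ball (0 : ℂ) 1, ∀ y ∈ Metric.ball (0 : ℂ) 1, G x + G y ≠ 0 := by
    intro x hx y hy h
    have h1 : G x = -G y := eq_neg_of_add_eq_zero_left h
    have h2 : x = y := hinj hx hy (by rw [← hG2 x hx, ← hG2 y hy, h1]; ring)
    rw [h2] at h1
    exact hG0 y (self_eq_neg.mp h1)
  -- A square root `G` of an injective function never takes opposite values, which is exactly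
  -- φ(x)φ(y) ≠ 1 after this Möbius map. The constant 4 comes from F'(0) = 4F(0)φ'(0).
  set φ : ℂ → ℂ := fun x => (G x - G 0) / (G x + G 0) with hφ
  have hφd : DifferentiableOn ℂ φ (Metric.ball 0 1) :=
    (hGd.sub_const _).div (hGd.add_const _) fun x hx => hneg x hx 0 h0B
  have hφi : InjOn φ (Metric.ball 0 1) := by
    intro x hx y hy h
    rw [hφ] at h
    simp only at h
    rw [div_eq_div_iff (hneg x hx 0 h0B) (hneg y hy 0 h0B)] at h
    have h1 : 2 * G 0 * (G x - G y) = 0 := by linear_combination h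
    have h2 : G x = G y := by
      simpa [sub_eq_zero, hG0] using h1
    exact hinj hx hy (by rw [← hG2 x hx, ← hG2 y hy, h2])
  have hφm : ∀ x ∈ Metric.ball (0 : ℂ) 1, ∀ y ∈ Metric.ball (0 : ℂ) 1, φ x * φ y ≠ 1 := by
    intro x hx y hy h
    rw [hφ] at h
    simp only at h
    rw [div_mul_div_comm, div_eq_one_iff_eq
      (mul_ne_zero (hneg x hx 0 h0B) (hneg y hy 0 h0B))] at h
    have h1 : 2 * G 0 * (G x + G y) = 0 := by linear_combination -h
    simp [hG0, hneg x hx y hy] at h1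
  have hmain := norm_deriv_le_one_of_mul_ne_one hφd hφi (by simp [hφ]) hφm
  have hGder : HasDerivAt G (deriv G 0) 0 :=
    (hGd.differentiableAt (Metric.isOpen_ball.mem_nhds h0B)).hasDerivAt
  have hφder : deriv φ 0 = deriv G 0 / (2 * G 0) := by
    have h1 := ((hGder.sub_const (G 0)).div (hGder.add_const (G 0)) (hneg 0 h0B 0 h0B)).deriv
    have h2 := hG0 0
    rw [hφ]
    refine h1.trans ?_
    field_simp
    ring
  have hFder : deriv F 0 = 2 * G 0 * deriv G 0 := by
    have h1 : F =ᶠ[𝓝 0] fun x => G x * G x := by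
      filter_upwards [Metric.isOpen_ball.mem_nhds h0B] with x hx
      exact (hG2 x hx).symm
    rw [h1.deriv_eq, (hGder.fun_mul hGder).deriv]
    ring
  have h3 : deriv F 0 = 4 * F 0 * deriv φ 0 := by
    rw [hFder, hφder, ← hG2 0 h0B]
    have h2 := hG0 0
    field_simp
    ring
  rw [h3, norm_mul, norm_mul, RCLike.norm_ofNat]
  exact mul_le_of_le_one_right (by positivity) hmain

/-- The automorphism of the unit disc sending `b` to `0`. -/
noncomputable def discMobius (b q : ℂ) : ℂ := (q - b) / (1 - conj b * q)

theorem discMobius_denom_ne_zero {b q : ℂ} (hb : ‖b‖ < 1) (hq : ‖q‖ < 1) :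
    1 - conj b * q ≠ 0 := by
  intro h
  have h1 : ‖conj b * q‖ = 1 := by rw [← sub_eq_zero.mp h, norm_one]
  rw [norm_mul, RCLike.norm_conj] at h1
  nlinarith [norm_nonneg b, norm_nonneg q]

theorem norm_discMobius_lt_one {b q : ℂ} (hb : ‖b‖ < 1) (hq : ‖q‖ < 1) :
    ‖discMobius b q‖ < 1 := by
  have h0 := discMobius_denom_ne_zero hb hq
  rw [discMobius, norm_div, div_lt_one (norm_pos_iff.mpr h0)]
  refine lt_of_pow_lt_pow_left₀ 2 (norm_nonneg _) ?_
  have h1 : ‖1 - conj b * q‖ ^ 2 - ‖q - b‖ ^ 2 = (1 - ‖b‖ ^ 2) * (1 - ‖q‖ ^ 2) := by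
    simp only [← Complex.normSq_eq_norm_sq, Complex.normSq_apply, Complex.sub_re, Complex.sub_im,
      Complex.mul_re, Complex.mul_im, Complex.conj_re, Complex.conj_im, Complex.one_re,
      Complex.one_im]
    ring
  have h2 : 0 < (1 - ‖b‖ ^ 2) * (1 - ‖q‖ ^ 2) :=
    mul_pos (by nlinarith [norm_nonneg b]) (by nlinarith [norm_nonneg q])
  linarith

theorem discMobius_self (b : ℂ) : discMobius b b = 0 := by simp [discMobius]

theorem hasDerivAt_discMobius {b q : ℂ} (hb : ‖b‖ < 1) (hq : ‖q‖ < 1) :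
    HasDerivAt (discMobius b) ((1 - (‖b‖ : ℂ) ^ 2) / (1 - conj b * q) ^ 2) q := by
  have h0 := discMobius_denom_ne_zero hb hq
  have h1 := ((hasDerivAt_id q).sub_const b).div
    (((hasDerivAt_id q).const_mul (conj b)).const_sub 1) h0
  refine h1.congr_deriv ?_
  rw [← Complex.conj_mul' b]
  simp only [id]
  congr 1
  ring

theorem one_sub_norm_sq_ne_zero {b : ℂ} (hb : ‖b‖ < 1) : (1 - (‖b‖ : ℂ) ^ 2) ≠ 0 := by
  have : (1 - ‖b‖ ^ 2 : ℝ) ≠ 0 := by nlinarith [norm_nonneg b]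
  exact_mod_cast this

theorem discMobius_injOn {b : ℂ} (hb : ‖b‖ < 1) : InjOn (discMobius b) (Metric.ball 0 1) := by
  intro x hx y hy h
  rw [mem_ball_zero_iff] at hx hy
  rw [discMobius, discMobius, div_eq_div_iff (discMobius_denom_ne_zero hb hx)
    (discMobius_denom_ne_zero hb hy)] at h
  have h1 : (1 - conj b * b) * (x - y) = 0 := by linear_combination h
  rw [Complex.conj_mul'] at h1
  exact sub_eq_zero.mp ((mul_eq_zero.mp h1).resolve_left (one_sub_norm_sq_ne_zero hb))

theorem norm_deriv_le_of_injOn {F : ℂ → ℂ} (hF : DifferentiableOn ℂ F (Metric.ball 0 1))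
    (hinj : InjOn F (Metric.ball 0 1)) (hne : ∀ x ∈ Metric.ball (0 : ℂ) 1, F x ≠ 0) {ζ : ℂ}
    (hζ : ‖ζ‖ < 1) : (1 - ‖ζ‖ ^ 2) * ‖deriv F ζ‖ ≤ 4 * ‖F ζ‖ := by
  -- `discMobius (-ζ)` sends 0 to ζ with derivative 1 - |ζ|² at 0.
  have hb : ‖-ζ‖ < 1 := by rwa [norm_neg]
  have hmaps : MapsTo (discMobius (-ζ)) (Metric.ball 0 1) (Metric.ball 0 1) := fun x hx => by
    rw [mem_ball_zero_iff] at hx ⊢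
    exact norm_discMobius_lt_one hb hx
  have hd : DifferentiableOn ℂ (discMobius (-ζ)) (Metric.ball 0 1) := fun x hx =>
    (hasDerivAt_discMobius hb (mem_ball_zero_iff.mp hx)).differentiableAt.differentiableWithinAt
  have h1 := norm_deriv_zero_le_of_injOn (hF.comp hd hmaps)
    (hinj.comp (discMobius_injOn hb) hmaps) fun x hx => hne _ (hmaps hx)
  have hv : discMobius (-ζ) 0 = ζ := by simp [discMobius]
  have hFζ : HasDerivAt F (deriv F ζ) (discMobius (-ζ) 0) := by
    rw [hv]
    exact (hF.differentiableAt
      (Metric.isOpen_ball.mem_nhds (mem_ball_zero_iff.mpr hζ))).hasDerivAt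
  rw [(hFζ.comp 0 (hasDerivAt_discMobius hb (by simp))).deriv, Function.comp_apply, hv] at h1
  have h2 : ‖(1 - (‖-ζ‖ : ℂ) ^ 2) / (1 - conj (-ζ) * 0) ^ 2‖ = 1 - ‖ζ‖ ^ 2 := by
    have h3 : (0 : ℝ) ≤ 1 - ‖ζ‖ ^ 2 := by nlinarith [norm_nonneg ζ]
    rw [mul_zero, sub_zero, one_pow, div_one, norm_neg]
    rw [← Complex.ofReal_pow, ← Complex.ofReal_one, ← Complex.ofReal_sub, Complex.norm_real,
      Real.norm_of_nonneg h3]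
  rwa [norm_mul, h2, mul_comm] at h1

theorem log_norm_sub_log_norm_le {F : ℂ → ℂ} (hF : DifferentiableOn ℂ F (Metric.ball 0 1))
    (hinj : InjOn F (Metric.ball 0 1)) (hne : ∀ x ∈ Metric.ball (0 : ℂ) 1, F x ≠ 0) {ζ : ℂ}
    (hζ : ‖ζ‖ < 1) : Real.log ‖F 0‖ - Real.log ‖F ζ‖ ≤ 4 * Real.artanh ‖ζ‖ := by
  obtain ⟨L, hL, hLe⟩ := (hasContLog_ball 1).exists_differentiableOn Metric.isOpen_ball hF hne
  have hlog : ∀ x ∈ Metric.ball (0 : ℂ) 1, Real.log ‖F x‖ = (L x).re := fun x hx => by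
    rw [← hLe x hx, Complex.norm_exp, Real.log_exp]
  have hLd : ∀ x ∈ Metric.ball (0 : ℂ) 1, HasDerivAt L (deriv L x) x := fun x hx =>
    (hL.differentiableAt (Metric.isOpen_ball.mem_nhds hx)).hasDerivAt
  have hLn : ∀ x ∈ Metric.ball (0 : ℂ) 1, ‖deriv L x‖ ≤ 4 / (1 - ‖x‖ ^ 2) := by
    intro x hx
    have hx' := mem_ball_zero_iff.mp hx
    have h1 := norm_deriv_le_of_injOn hF hinj hne hx'
    have h2 : F =ᶠ[𝓝 x] fun y => Complex.exp (L y) := by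
      filter_upwards [Metric.isOpen_ball.mem_nhds hx] with y hy
      exact (hLe y hy).symm
    rw [h2.deriv_eq, (hLd x hx).cexp.deriv, hLe x hx, norm_mul] at h1
    have h3 : 0 < ‖F x‖ := norm_pos_iff.mpr (hne x hx)
    rw [le_div_iff₀ (by nlinarith [norm_nonneg x])]
    nlinarith
  -- The second term is 4 artanh(t|ζ|); its derivative matches the bound on L' along the radius, so
  -- `v` is nondecreasing.
  set v : ℝ → ℝ := fun t => (L (t * ζ)).re +
    2 * (Real.log (1 + t * ‖ζ‖) - Real.log (1 - t * ‖ζ‖)) with hv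
  have hin : ∀ t ∈ Icc (0 : ℝ) 1, t * ‖ζ‖ < 1 := fun t ht =>
    lt_of_le_of_lt (mul_le_of_le_one_left (norm_nonneg _) ht.2) hζ
  have hin2 : ∀ t ∈ Icc (0 : ℝ) 1, (t * ζ : ℂ) ∈ Metric.ball (0 : ℂ) 1 := fun t ht => by
    rw [mem_ball_zero_iff, norm_mul, Complex.norm_real, Real.norm_of_nonneg ht.1]
    exact hin t ht
  have hder : ∀ t ∈ Icc (0 : ℝ) 1, HasDerivAt v ((deriv L (t * ζ) * ζ).re +
      2 * (‖ζ‖ / (1 + t * ‖ζ‖) - (-‖ζ‖) / (1 - t * ‖ζ‖))) t := by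
    intro t ht
    have h1 : HasDerivAt (fun s : ℝ => (s * ζ : ℂ)) ζ t := by
      simpa using (Complex.ofRealCLM.hasDerivAt (x := t)).mul_const ζ
    have h2 : HasDerivAt (fun s : ℝ => L (s * ζ)) (deriv L (t * ζ) * ζ) t :=
      (hLd _ (hin2 t ht)).comp t h1
    have h3 : HasDerivAt (fun s : ℝ => (L (s * ζ)).re) (deriv L (t * ζ) * ζ).re t :=
      Complex.reCLM.hasFDerivAt.comp_hasDerivAt t h2
    have h4 : HasDerivAt (fun s : ℝ => s * ‖ζ‖) ‖ζ‖ t := by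
      simpa using (hasDerivAt_id t).mul_const ‖ζ‖
    have h5 : 0 ≤ t * ‖ζ‖ := mul_nonneg ht.1 (norm_nonneg _)
    have h6 := hin t ht
    exact h3.add ((((h4.const_add 1).log (by linarith)).sub
      ((h4.const_sub 1).log (by linarith))).const_mul 2)
  have hmono : MonotoneOn v (Icc 0 1) := by
    refine monotoneOn_of_hasDerivWithinAt_nonneg (convex_Icc 0 1)
      (fun t ht => (hder t ht).continuousAt.continuousWithinAt)
      (fun t ht => (hder t (interior_subset ht)).hasDerivWithinAt) fun t ht => ?_
    have ht' := interior_subset ht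
    have h1 := hin t ht'
    have h5 : 0 ≤ t * ‖ζ‖ := mul_nonneg ht'.1 (norm_nonneg _)
    have h2 := hLn _ (hin2 t ht')
    rw [norm_mul, Complex.norm_real, Real.norm_of_nonneg ht'.1] at h2
    have h3 : -(‖deriv L (t * ζ)‖ * ‖ζ‖) ≤ (deriv L (t * ζ) * ζ).re := by
      rw [← norm_mul]
      exact neg_le_of_abs_le (Complex.abs_re_le_norm _)
    have h4 : ‖deriv L (t * ζ)‖ * ‖ζ‖ ≤ 4 / (1 - (t * ‖ζ‖) ^ 2) * ‖ζ‖ := by gcongr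
    have h6 : 2 * (‖ζ‖ / (1 + t * ‖ζ‖) - (-‖ζ‖) / (1 - t * ‖ζ‖)) =
        4 / (1 - (t * ‖ζ‖) ^ 2) * ‖ζ‖ := by
      have e1 : 1 + t * ‖ζ‖ ≠ 0 := by linarith
      have e2 : 1 - t * ‖ζ‖ ≠ 0 := by linarith
      generalize t * ‖ζ‖ = a at e1 e2 ⊢
      have e3 : 1 - a ^ 2 = (1 + a) * (1 - a) := by ring
      rw [e3]
      field_simp
      ring
    linarith
  have hend := hmono (left_mem_Icc.mpr zero_le_one) (right_mem_Icc.mpr zero_le_one) zero_le_one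
  simp only [hv, Complex.ofReal_zero, zero_mul, add_zero, sub_zero, Real.log_one, mul_zero,
    Complex.ofReal_one, one_mul] at hend
  rw [hlog 0 (by simp), hlog ζ (by simpa using hζ),
    Real.artanh_eq_half_log ⟨by linarith [norm_nonneg ζ], hζ.le⟩,
    Real.log_div (by linarith [norm_nonneg ζ]) (by linarith)]
  linarith

end Koebe

/-! ### Conformal embeddings and the planar Carathéodory metric -/

section DiscEmbedding

open Topology ComplexConjugate

/-- Conformal embeddings of `G` into the unit disc. -/
structure IsDiscEmbedding (G : Set ℂ) (f : ℂ → ℂ) : Prop where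
  differentiableOn : DifferentiableOn ℂ f G
  norm_lt_one : ∀ x ∈ G, ‖f x‖ < 1
  injOn : InjOn f G
  deriv_ne_zero : ∀ x ∈ G, deriv f x ≠ 0

variable {G : Set ℂ} {f : ℂ → ℂ}

theorem IsDiscEmbedding.hasDerivAt (hf : IsDiscEmbedding G f) (hG : IsOpen G) {x : ℂ}
    (hx : x ∈ G) : HasDerivAt f (deriv f x) x :=
  (hf.differentiableOn.differentiableAt (hG.mem_nhds hx)).hasDerivAt

theorem IsDiscEmbedding.hasDerivAt_discMobius (hf : IsDiscEmbedding G f) (hG : IsOpen G) {b : ℂ}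
    (hb : ‖b‖ < 1) {x : ℂ} (hx : x ∈ G) : HasDerivAt (fun x => discMobius b (f x))
      ((1 - (‖b‖ : ℂ) ^ 2) / (1 - conj b * f x) ^ 2 * deriv f x) x :=
  (_root_.hasDerivAt_discMobius hb (hf.norm_lt_one x hx)).comp x (hf.hasDerivAt hG hx)

theorem IsDiscEmbedding.discMobius (hf : IsDiscEmbedding G f) (hG : IsOpen G) {b : ℂ}
    (hb : ‖b‖ < 1) : IsDiscEmbedding G fun x => discMobius b (f x) where
  differentiableOn x hx := (hf.hasDerivAt_discMobius hG hb hx).differentiableAt.differentiableWithinAt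
  norm_lt_one x hx := norm_discMobius_lt_one hb (hf.norm_lt_one x hx)
  injOn x hx y hy h := hf.injOn hx hy (discMobius_injOn hb
    (mem_ball_zero_iff.mpr (hf.norm_lt_one x hx)) (mem_ball_zero_iff.mpr (hf.norm_lt_one y hy)) h)
  deriv_ne_zero x hx := by
    rw [(hf.hasDerivAt_discMobius hG hb hx).deriv]
    exact mul_ne_zero (div_ne_zero (one_sub_norm_sq_ne_zero hb)
      (pow_ne_zero 2 (discMobius_denom_ne_zero hb (hf.norm_lt_one x hx)))) (hf.deriv_ne_zero x hx)

theorem HasContLog.exists_sqrt (hlog : HasContLog G) (hG : IsOpen G)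
    (hf : DifferentiableOn ℂ f G) (hne : ∀ x ∈ G, f x ≠ 0) :
    ∃ q : ℂ → ℂ, DifferentiableOn ℂ q G ∧ (∀ x ∈ G, q x * q x = f x) ∧
      ∀ x ∈ G, 2 * q x * deriv q x = deriv f x := by
  obtain ⟨L, hL, hLe⟩ := hlog.exists_differentiableOn hG hf hne
  have hq : DifferentiableOn ℂ (fun x => Complex.exp (L x / 2)) G := (hL.div_const 2).cexp
  have hq2 : ∀ x ∈ G, Complex.exp (L x / 2) * Complex.exp (L x / 2) = f x := fun x hx => by
    rw [← Complex.exp_add, add_halves, hLe x hx]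
  refine ⟨_, hq, hq2, fun x hx => ?_⟩
  have h1 : f =ᶠ[𝓝 x] fun y => Complex.exp (L y / 2) * Complex.exp (L y / 2) := by
    filter_upwards [hG.mem_nhds hx] with y hy
    exact (hq2 y hy).symm
  have h2 := (hq.differentiableAt (hG.mem_nhds hx)).hasDerivAt
  rw [h1.deriv_eq, (h2.fun_mul h2).deriv]
  ring

theorem IsDiscEmbedding.exists_sqrt (hf : IsDiscEmbedding G f) (hlog : HasContLog G)
    (hG : IsOpen G) (hne : ∀ x ∈ G, f x ≠ 0) :
    ∃ q : ℂ → ℂ, IsDiscEmbedding G q ∧ (∀ x ∈ G, q x * q x = f x) ∧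
      ∀ x ∈ G, 2 * q x * deriv q x = deriv f x := by
  obtain ⟨q, hq, hq2, hqd⟩ := hlog.exists_sqrt hG hf.differentiableOn hne
  refine ⟨q, ⟨hq, fun x hx => ?_, fun x hx y hy h => ?_, fun x hx h => ?_⟩, hq2, hqd⟩
  · have h1 := hf.norm_lt_one x hx
    rw [← hq2 x hx, norm_mul] at h1
    nlinarith [norm_nonneg (q x)]
  · exact hf.injOn hx hy (by rw [← hq2 x hx, ← hq2 y hy, h])
  · exact hf.deriv_ne_zero x hx (by rw [← hqd x hx, h, mul_zero])

/-- A square root s of the identity never takes opposite values, so its image misses a disc around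
-s(z). Inversion about that point lands in the unit disc. -/
theorem exists_isDiscEmbedding (hG : IsOpen G) (hlog : HasContLog G) (h0 : (0 : ℂ) ∉ G) {z : ℂ}
    (hz : z ∈ G) : ∃ f, IsDiscEmbedding G f ∧ f z = 0 := by
  have hne : ∀ x ∈ G, x ≠ 0 := fun x hx h => h0 (h ▸ hx)
  obtain ⟨s, hs, hs2, hsd⟩ := hlog.exists_sqrt hG (f := fun x => x) differentiableOn_id hne
  have hs0 : ∀ x ∈ G, s x ≠ 0 := fun x hx h => hne x hx (by rw [← hs2 x hx, h, mul_zero])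
  have hsd0 : ∀ x ∈ G, deriv s x ≠ 0 := fun x hx h => by
    have := hsd x hx
    rw [h, mul_zero, deriv_id''] at this
    exact zero_ne_one this
  have hsum : ∀ x ∈ G, ∀ y ∈ G, s x + s y ≠ 0 := by
    intro x hx y hy h
    have h1 : s x = -s y := eq_neg_of_add_eq_zero_left h
    have h2 : x = y := by rw [← hs2 x hx, ← hs2 y hy, h1]; ring
    rw [h2] at h1
    exact hs0 y hy (self_eq_neg.mp h1)
  have hnhds : s '' G ∈ 𝓝 (s z) := by
    rw [← (hasStrictDerivAt_of_isOpen hs hG hz).map_nhds_eq (hsd0 z hz)]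
    exact Filter.image_mem_map (hG.mem_nhds hz)
  obtain ⟨r, hr, hrs⟩ := Metric.mem_nhds_iff.mp hnhds
  have hfar : ∀ x ∈ G, r ≤ ‖s x + s z‖ := by
    intro x hx
    by_contra! h
    have hmem : -s x ∈ Metric.ball (s z) r := by
      rw [Metric.mem_ball, dist_eq_norm, ← norm_neg, neg_sub, sub_neg_eq_add, add_comm]
      exact h
    obtain ⟨y, hy, hyx⟩ := hrs hmem
    exact hsum x hx y hy (by rw [hyx, add_neg_cancel])
  have hsder : ∀ x ∈ G, HasDerivAt s (deriv s x) x := fun x hx =>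
    (hs.differentiableAt (hG.mem_nhds hx)).hasDerivAt
  have hder : ∀ x ∈ G, HasDerivAt (fun x => ((r / 2 : ℝ) : ℂ) / (s x + s z))
      (-((r / 2 : ℝ) : ℂ) * deriv s x / (s x + s z) ^ 2) x := by
    intro x hx
    refine ((hasDerivAt_const x _).fun_div ((hsder x hx).add_const (s z))
      (hsum x hx z hz)).congr_deriv ?_
    ring
  have hr0 : ((r / 2 : ℝ) : ℂ) ≠ 0 := Complex.ofReal_ne_zero.mpr (by positivity)
  have hemb : IsDiscEmbedding G fun x => ((r / 2 : ℝ) : ℂ) / (s x + s z) := by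
    refine ⟨fun x hx => (hder x hx).differentiableAt.differentiableWithinAt, fun x hx => ?_,
      fun x hx y hy h => ?_, fun x hx => ?_⟩
    · have := hfar x hx
      rw [norm_div, Complex.norm_real, Real.norm_of_nonneg (by positivity),
        div_lt_one (by linarith)]
      linarith
    · rw [div_eq_div_iff (hsum x hx z hz) (hsum y hy z hz)] at h
      have h1 := mul_left_cancel₀ hr0 h
      have h2 : s x = s y := (add_right_cancel h1).symm
      rw [← hs2 x hx, ← hs2 y hy, h2]
    · rw [(hder x hx).deriv]
      exact div_ne_zero (mul_ne_zero (neg_ne_zero.mpr hr0) (hsd0 x hx))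
        (pow_ne_zero 2 (hsum x hx z hz))
  exact ⟨_, hemb.discMobius hG (hemb.norm_lt_one z hz), discMobius_self _⟩

/-- The square root step in the proof of the Riemann mapping theorem. -/
theorem IsDiscEmbedding.exists_expansion (hf : IsDiscEmbedding G f) (hlog : HasContLog G)
    (hG : IsOpen G) {z : ℂ} (hz : z ∈ G) (hfz : f z = 0) {c : ℂ} (hc : ‖c‖ < 1)
    (hcf : c ∉ f '' G) :
    ∃ g, IsDiscEmbedding G g ∧ g z = 0 ∧
      ‖deriv g z‖ = (1 + ‖c‖) / (2 * √‖c‖) * ‖deriv f z‖ := by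
  have hc0 : c ≠ 0 := fun h => hcf ⟨z, hz, by rw [hfz, h]⟩
  -- As `c` is omitted, the transformed embedding has no zero. With |q(z)|² = |c| the factor is (1 -
  -- |c|²) / (2√|c| (1 - |c|)).
  obtain ⟨q, hq, hq2, hqd⟩ := (hf.discMobius hG hc).exists_sqrt hlog hG (fun x hx h => by
    rw [_root_.discMobius, div_eq_zero_iff] at h
    exact h.elim (fun h => hcf ⟨x, hx, sub_eq_zero.mp h⟩)
      (discMobius_denom_ne_zero hc (hf.norm_lt_one x hx)))
  have hqz := hq.norm_lt_one z hz
  refine ⟨_, hq.discMobius hG hqz, discMobius_self _, ?_⟩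
  have h1 : ‖q z‖ ^ 2 = ‖c‖ := by
    rw [sq, ← norm_mul, hq2 z hz, hfz]
    simp [_root_.discMobius]
  have h2 : √‖c‖ = ‖q z‖ := by rw [← h1, Real.sqrt_sq (norm_nonneg _)]
  have h3 : 2 * ‖q z‖ * ‖deriv q z‖ = (1 - ‖c‖ ^ 2) * ‖deriv f z‖ := by
    have h4 := congrArg norm (hqd z hz)
    rw [(hf.hasDerivAt_discMobius hG hc hz).deriv, hfz, mul_zero, sub_zero, one_pow, div_one] at h4
    have h5 : ‖(1 - (‖c‖ : ℂ) ^ 2)‖ = 1 - ‖c‖ ^ 2 := by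
      rw [← Complex.ofReal_pow, ← Complex.ofReal_one, ← Complex.ofReal_sub, Complex.norm_real,
        Real.norm_of_nonneg (by nlinarith [norm_nonneg c])]
    simpa only [norm_mul, h5, RCLike.norm_ofNat] using h4
  have hqpos : 0 < ‖q z‖ := by
    rw [← h2]; exact Real.sqrt_pos.mpr (norm_pos_iff.mpr hc0)
  have hpos : 0 < 1 - ‖q z‖ ^ 2 := by nlinarith
  rw [(hq.hasDerivAt_discMobius hG hqz hz).deriv, Complex.conj_mul', h2, norm_mul, norm_div,
    norm_pow]
  have h6 : ‖(1 - (‖q z‖ : ℂ) ^ 2)‖ = 1 - ‖q z‖ ^ 2 := by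
    rw [← Complex.ofReal_pow, ← Complex.ofReal_one, ← Complex.ofReal_sub, Complex.norm_real,
      Real.norm_of_nonneg hpos.le]
  rw [h6]
  have h7 : ‖deriv q z‖ = (1 - ‖c‖ ^ 2) * ‖deriv f z‖ / (2 * ‖q z‖) := by
    rw [← h3]; field_simp
  rw [h7, ← h1]
  field_simp
  ring

/-- Conformal embeddings into the disc whose image contains a prescribed smaller disc. -/
theorem exists_isDiscEmbedding_ball_subset (hG : IsOpen G) (hlog : HasContLog G)
    (h0 : (0 : ℂ) ∉ G) {z : ℂ} (hz : z ∈ G) {ρ : ℝ} (hρ0 : 0 < ρ) (hρ1 : ρ < 1) :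
    ∃ f, IsDiscEmbedding G f ∧ f z = 0 ∧ Metric.ball 0 ρ ⊆ f '' G := by
  set S : Set ℝ := {t | ∃ f, IsDiscEmbedding G f ∧ f z = 0 ∧ ‖deriv f z‖ = t} with hS
  obtain ⟨R, hR, hRG⟩ := Metric.isOpen_iff.mp hG z hz
  have hbdd : BddAbove S := by
    refine ⟨1 / R, ?_⟩
    rintro _ ⟨f, hf, hfz, rfl⟩
    refine Complex.norm_deriv_le_div_of_mapsTo_ball (hf.differentiableOn.mono hRG)
      (fun x hx => ?_) hR
    rw [hfz, mem_closedBall_zero_iff]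
    exact (hf.norm_lt_one x (hRG hx)).le
  obtain ⟨f₀, hf₀, hf₀z⟩ := exists_isDiscEmbedding hG hlog h0 hz
  have hpos : 0 < sSup S := (norm_pos_iff.mpr (hf₀.deriv_ne_zero z hz)).trans_le
    (le_csSup hbdd ⟨f₀, hf₀, hf₀z, rfl⟩)
  have hsρ : 0 < √ρ := Real.sqrt_pos.mpr hρ0
  have hsρ2 : √ρ ^ 2 = ρ := Real.sq_sqrt hρ0.le
  have hsρ1 : √ρ < 1 := by nlinarith
  -- The supremum of |f'(z)| need not be attained here: an f within the factor κ > 1 of it suffices.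
  -- Omitting a point of modulus below ρ would allow an expansion by at least κ, as (1 + t)/(2√t)
  -- decreases on (0, 1].
  set κ : ℝ := (1 + ρ) / (2 * √ρ) with hκ
  have hκ1 : 1 < κ := by
    rw [hκ, lt_div_iff₀ (by positivity)]
    nlinarith
  have hκ0 : 0 < κ := zero_lt_one.trans hκ1
  obtain ⟨_, ⟨f, hf, hfz, rfl⟩, hlt⟩ := exists_lt_of_lt_csSup
    (⟨_, f₀, hf₀, hf₀z, rfl⟩ : S.Nonempty) (div_lt_self hpos hκ1)
  rw [div_lt_iff₀ hκ0] at hlt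
  refine ⟨f, hf, hfz, fun c hc => ?_⟩
  by_contra hcf
  rw [mem_ball_zero_iff] at hc
  obtain ⟨g, hg, hgz, hgd⟩ := hf.exists_expansion hlog hG hz hfz (hc.trans hρ1) hcf
  have hc0 : c ≠ 0 := fun h => hcf ⟨z, hz, by rw [hfz, h]⟩
  have hsc : 0 < √‖c‖ := Real.sqrt_pos.mpr (norm_pos_iff.mpr hc0)
  have hsc2 : √‖c‖ ^ 2 = ‖c‖ := Real.sq_sqrt (norm_nonneg c)
  have hscρ : √‖c‖ ≤ √ρ := Real.sqrt_le_sqrt hc.le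
  have hle : κ ≤ (1 + ‖c‖) / (2 * √‖c‖) := by
    rw [hκ, div_le_div_iff₀ (by positivity) (by positivity), ← hsc2, ← hsρ2]
    rw [Real.sqrt_sq hsρ.le, Real.sqrt_sq hsc.le]
    have h1 : √‖c‖ * √ρ ≤ 1 := by nlinarith
    nlinarith [mul_nonneg (sub_nonneg.mpr hscρ) (sub_nonneg.mpr h1)]
  have h1 : ‖deriv g z‖ ≤ sSup S := le_csSup hbdd ⟨g, hg, hgz, rfl⟩
  rw [hgd] at h1
  have h2 : κ * ‖deriv f z‖ ≤ (1 + ‖c‖) / (2 * √‖c‖) * ‖deriv f z‖ := by gcongr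
  linarith

theorem IsDiscEmbedding.hasDerivAt_inverse (hf : IsDiscEmbedding G f) (hG : IsOpen G) {x : ℂ}
    (hx : x ∈ G) : HasDerivAt (Function.invFunOn f G) (deriv f x)⁻¹ (f x) := by
  have hstrict := hasStrictDerivAt_of_isOpen hf.differentiableOn hG hx
  have hd := hf.deriv_ne_zero x hx
  set g := HasStrictDerivAt.localInverse f (deriv f x) x hstrict hd
  have hg : HasStrictDerivAt g (deriv f x)⁻¹ (f x) := hstrict.to_localInverse hd
  have hgx : g (f x) = x := HasStrictFDerivAt.localInverse_apply_image
    (hstrict.hasStrictFDerivAt_equiv hd)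
  have hright : ∀ᶠ w in 𝓝 (f x), f (g w) = w := HasStrictFDerivAt.eventually_right_inverse
    (hstrict.hasStrictFDerivAt_equiv hd)
  have hmem : ∀ᶠ w in 𝓝 (f x), g w ∈ G :=
    hg.hasDerivAt.continuousAt.eventually_mem (by rw [hgx]; exact hG.mem_nhds hx)
  refine hg.hasDerivAt.congr_of_eventuallyEq ?_
  filter_upwards [hright, hmem] with w hw hwG
  have hw' : w ∈ f '' G := ⟨g w, hwG, hw⟩
  exact hf.injOn (Function.invFunOn_mem hw') hwG ((Function.invFunOn_eq hw').trans hw.symm)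

/-- The rescaled inverse of a conformal embedding whose image contains the disc of radius `ρ`. -/
theorem IsDiscEmbedding.exists_inverse (hf : IsDiscEmbedding G f) (hG : IsOpen G) {ρ : ℝ}
    (hρ : 0 < ρ) (hsub : Metric.ball 0 ρ ⊆ f '' G) :
    ∃ F : ℂ → ℂ, DifferentiableOn ℂ F (Metric.ball 0 1) ∧ InjOn F (Metric.ball 0 1) ∧
      (∀ x ∈ Metric.ball (0 : ℂ) 1, F x ∈ G) ∧
      ∀ x ∈ G, ‖f x‖ < ρ → F (f x / ρ) = x ∧ deriv F (f x / ρ) = ρ / deriv f x := by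
  have hρ' : (ρ : ℂ) ≠ 0 := Complex.ofReal_ne_zero.mpr hρ.ne'
  have hmem : ∀ ζ ∈ Metric.ball (0 : ℂ) 1, (ρ : ℂ) * ζ ∈ f '' G := fun ζ hζ => hsub (by
    rw [mem_ball_zero_iff] at hζ ⊢
    rw [norm_mul, Complex.norm_real, Real.norm_of_nonneg hρ.le]
    nlinarith [norm_nonneg ζ])
  have hinv : ∀ x ∈ G, Function.invFunOn f G (f x) = x := fun x hx =>
    hf.injOn.leftInvOn_invFunOn hx
  have hder : ∀ x ∈ G, HasDerivAt (fun ζ : ℂ => Function.invFunOn f G (ρ * ζ))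
      (ρ / deriv f x) (f x / ρ) := by
    intro x hx
    have h1 : HasDerivAt (fun ζ : ℂ => (ρ : ℂ) * ζ) ρ (f x / ρ) := by
      simpa using (hasDerivAt_id (f x / ρ)).const_mul (ρ : ℂ)
    have h2 : HasDerivAt (Function.invFunOn f G) (deriv f x)⁻¹ (ρ * (f x / ρ)) := by
      rw [mul_div_cancel₀ _ hρ']
      exact hf.hasDerivAt_inverse hG hx
    refine (h2.comp (f x / ρ) h1).congr_deriv ?_
    rw [div_eq_mul_inv, mul_comm]
  refine ⟨fun ζ => Function.invFunOn f G (ρ * ζ), fun ζ hζ => ?_, fun ζ hζ ξ hξ h => ?_,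
    fun ζ hζ => Function.invFunOn_mem (hmem ζ hζ), fun x hx _ => ⟨?_, (hder x hx).deriv⟩⟩
  · obtain ⟨x, hx, hxζ⟩ := hmem ζ hζ
    have h1 : ζ = f x / ρ := by rw [hxζ, mul_div_cancel_left₀ _ hρ']
    rw [h1]
    exact (hder x hx).differentiableAt.differentiableWithinAt
  · have h1 := congrArg f h
    simp only [Function.invFunOn_eq (hmem ζ hζ), Function.invFunOn_eq (hmem ξ hξ)] at h1
    exact mul_left_cancel₀ hρ' h1
  · simp only
    rw [mul_div_cancel₀ _ hρ', hinv x hx]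

/-- The infinitesimal Carathéodory metric of a planar domain with logarithms omitting the origin
is at least `1 / (4 |z|)`. -/
theorem exists_deriv_ge (hG : IsOpen G) (hlog : HasContLog G) (h0 : (0 : ℂ) ∉ G) {z : ℂ}
    (hz : z ∈ G) {ρ : ℝ} (hρ0 : 0 < ρ) (hρ1 : ρ < 1) :
    ∃ f : ℂ → ℂ, DifferentiableOn ℂ f G ∧ (∀ x ∈ G, ‖f x‖ < 1) ∧ f z = 0 ∧
      ρ ≤ 4 * ‖z‖ * ‖deriv f z‖ := by
  obtain ⟨f, hf, hfz, hsub⟩ := exists_isDiscEmbedding_ball_subset hG hlog h0 hz hρ0 hρ1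
  refine ⟨f, hf.differentiableOn, hf.norm_lt_one, hfz, ?_⟩
  obtain ⟨F, hFd, hFi, hFG, hF⟩ := hf.exists_inverse hG hρ0 hsub
  have h1 := norm_deriv_zero_le_of_injOn hFd hFi fun x hx h => h0 (h ▸ hFG x hx)
  obtain ⟨h2, h3⟩ := hF z hz (by rw [hfz, norm_zero]; exact hρ0)
  rw [hfz, zero_div] at h2 h3
  rw [h2, h3, norm_div, Complex.norm_real, Real.norm_of_nonneg hρ0.le,
    div_le_iff₀ (norm_pos_iff.mpr (hf.deriv_ne_zero z hz))] at h1
  exact h1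

/-- The Carathéodory distance of a planar domain with logarithms omitting the origin is at least
`log (|z| / |w|) / 4`. -/
theorem log_div_le_of_artanh_le (hG : IsOpen G) (hlog : HasContLog G) (h0 : (0 : ℂ) ∉ G)
    {z w : ℂ} (hz : z ∈ G) (hw : w ∈ G) {T : ℝ}
    (hT : ∀ f : ℂ → ℂ, DifferentiableOn ℂ f G → (∀ x ∈ G, ‖f x‖ < 1) → f z = 0 →
      Real.artanh ‖f w‖ ≤ T) : Real.log (‖z‖ / ‖w‖) ≤ 4 * T := by
  have hz0 : ‖z‖ ≠ 0 := norm_ne_zero_iff.mpr fun h => h0 (h ▸ hz)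
  have hw0 : ‖w‖ ≠ 0 := norm_ne_zero_iff.mpr fun h => h0 (h ▸ hw)
  have hT0 : 0 ≤ T := by
    simpa using hT 0 (differentiableOn_const 0) (by simp) rfl
  -- By hypothesis each competitor has |f(w)| ≤ t₀. Rescaling the inverse of an embedding to the
  -- unit disc puts the preimage of w at radius at most t₀/ρ, and ρ → 1 recovers T.
  set t₀ := Real.tanh T with ht₀
  have ht₀mem : t₀ ∈ Ioo (-1 : ℝ) 1 := ⟨Real.neg_one_lt_tanh T, Real.tanh_lt_one T⟩
  have ht₀0 : 0 ≤ t₀ := by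
    rw [ht₀, Real.tanh_eq_sinh_div_cosh]
    exact div_nonneg (Real.sinh_nonneg_iff.mpr hT0) (Real.cosh_pos T).le
  have hkey : ∀ ρ ∈ Ioo t₀ 1, 0 < ρ → Real.log (‖z‖ / ‖w‖) ≤ 4 * Real.artanh (t₀ / ρ) := by
    intro ρ hρ hρ0
    obtain ⟨f, hf, hfz, hsub⟩ := exists_isDiscEmbedding_ball_subset hG hlog h0 hz hρ0 hρ.2
    obtain ⟨F, hFd, hFi, hFG, hF⟩ := hf.exists_inverse hG hρ0 hsub
    have h1 := hT f hf.differentiableOn hf.norm_lt_one hfz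
    have hfw := hf.norm_lt_one w hw
    have h2 : ‖f w‖ ≤ t₀ := by
      rw [← Real.artanh_tanh T, Real.artanh_le_artanh_iff
        ⟨by linarith [norm_nonneg (f w)], hfw⟩ ht₀mem] at h1
      exact h1
    have h3 : ‖f w / ρ‖ ≤ t₀ / ρ := by
      rw [norm_div, Complex.norm_real, Real.norm_of_nonneg hρ0.le]
      gcongr
    have h4 : t₀ / ρ < 1 := (div_lt_one hρ0).mpr hρ.1
    have h5 := log_norm_sub_log_norm_le hFd hFi (fun x hx h => h0 (h ▸ hFG x hx))
      (h3.trans_lt h4)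
    have h6 := (hF z hz (by rw [hfz, norm_zero]; exact hρ0)).1
    rw [hfz, zero_div] at h6
    rw [h6, (hF w hw (h2.trans_lt hρ.1)).1] at h5
    rw [Real.log_div hz0 hw0]
    have h7 : Real.artanh ‖f w / ρ‖ ≤ Real.artanh (t₀ / ρ) :=
      Real.artanh_le_artanh (by linarith [norm_nonneg (f w / ρ)]) h4 h3
    linarith
  have hcont : Filter.Tendsto (fun ρ : ℝ => 4 * Real.artanh (t₀ / ρ)) (𝓝[<] 1)
      (𝓝 (4 * Real.artanh (t₀ / 1))) := by
    have h1 : ContinuousAt (fun ρ : ℝ => t₀ / ρ) 1 := continuousAt_const.div continuousAt_id one_ne_zero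
    have h2 : ContinuousAt Real.artanh (t₀ / 1) := by
      rw [div_one]
      have h3 : Real.artanh =ᶠ[𝓝 t₀] fun x => 1 / 2 * Real.log ((1 + x) / (1 - x)) := by
        filter_upwards [isOpen_Ioo.mem_nhds ht₀mem] with x hx
        exact Real.artanh_eq_half_log (Ioo_subset_Icc_self hx)
      refine ContinuousAt.congr ?_ h3.symm
      have h4 : 1 - t₀ ≠ 0 := by linarith [ht₀mem.2]
      have h5 : (1 + t₀) / (1 - t₀) ≠ 0 := div_ne_zero (by linarith [ht₀mem.1]) h4
      fun_prop (disch := assumption)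
    exact ((h2.comp (f := fun ρ : ℝ => t₀ / ρ) h1).const_mul 4).tendsto.mono_left
      nhdsWithin_le_nhds
  rw [div_one, ht₀, Real.artanh_tanh] at hcont
  refine ge_of_tendsto hcont ?_
  filter_upwards [Ioo_mem_nhdsLT ht₀mem.2] with ρ hρ
  exact hkey ρ hρ (ht₀0.trans_lt hρ.1)

end DiscEmbedding

/-! ### The Bergman metric dominates the Carathéodory metric -/

section Bergman

open Topology

variable {n : ℕ} {D : Set (EuclideanSpace ℂ (Fin n))}

theorem lintegral_enorm_sq_le_one {X : Type*} [MeasurableSpace X] {μ : Measure X} {f : X → ℂ}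
    (hf : eLpNorm f 2 μ ≤ 1) : ∫⁻ x, ‖f x‖ₑ ^ 2 ∂μ ≤ 1 := by
  have h1 := eLpNorm_nnreal_pow_eq_lintegral (μ := μ) (f := f) (p := 2) two_ne_zero
  simp only [NNReal.coe_ofNat, ENNReal.rpow_ofNat, ENNReal.coe_ofNat] at h1
  rw [← h1]
  exact pow_le_one₀ zero_le hf

/-- The mean value inequality for f² on a ball inside D bounds the kernel by the inverse volume of
the ball. -/
theorem bergmanKernelDiag_ne_top (hD : IsOpen D) {z : EuclideanSpace ℂ (Fin n)} (hz : z ∈ D) :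
    bergmanKernelDiag D z ≠ ⊤ := by
  obtain ⟨r, hr, hrD⟩ := Metric.isOpen_iff.mp hD z hz
  set V : ℝ≥0∞ := volume (Metric.ball (0 : EuclideanSpace ℂ (Fin n)) r) with hV
  have hV0 : V ≠ 0 := (Metric.measure_ball_pos volume _ hr).ne'
  have hVt : V ≠ ⊤ := measure_ball_lt_top.ne
  refine ne_top_of_le_ne_top (ENNReal.inv_ne_top.mpr hV0) (iSup₂_le fun f hf => ?_)
  obtain ⟨⟨hfd, -⟩, hf1⟩ := hf
  have hmaps : ∀ x ∈ Metric.ball (0 : EuclideanSpace ℂ (Fin n)) r, z + x ∈ D := fun x hx =>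
    hrD (by simpa using hx)
  have hmean := enorm_zero_mul_lintegral_le (μ := (volume : Measure (EuclideanSpace ℂ (Fin n))))
    measurePreserving_circleMap_smul (Metric.isOpen_ball (x := 0) (ε := r))
    (fun x hx c hc => by
      rw [mem_ball_zero_iff] at hx ⊢
      rw [norm_smul]
      exact lt_of_le_of_lt (mul_le_of_le_one_left (norm_nonneg _) hc) hx)
    (ψ := fun x => f (z + x) ^ 2)
    ((hfd.comp (by fun_prop) hmaps).pow 2)
    (k := (Metric.ball 0 r).indicator 1) (measurable_one.indicator measurableSet_ball)
    (fun θ x => by simp [Set.indicator, norm_smul])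
    (fun x hx => indicator_of_notMem hx _)
  rw [lintegral_indicator_one measurableSet_ball, ← hV, add_zero, enorm_pow] at hmean
  rw [ENNReal.le_inv_iff_mul_le]
  refine hmean.trans ?_
  calc ∫⁻ x, ‖f (z + x) ^ 2‖ₑ * (Metric.ball 0 r).indicator 1 x
      ≤ ∫⁻ x, D.indicator (fun y => ‖f y‖ₑ ^ 2) (z + x) := by
        refine lintegral_mono fun x => ?_
        by_cases hx : x ∈ Metric.ball (0 : EuclideanSpace ℂ (Fin n)) r
        · simp [hmaps x hx, indicator_of_mem hx, enorm_pow]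
        · simp [indicator_of_notMem hx]
    _ = ∫⁻ y in D, ‖f y‖ₑ ^ 2 := by
        rw [lintegral_add_left_eq_self (μ := volume)
          (fun y => D.indicator (fun y => ‖f y‖ₑ ^ 2) y) z, lintegral_indicator hD.measurableSet]
    _ ≤ 1 := lintegral_enorm_sq_le_one hf1

theorem exists_normalized_bergmanSpace {g : EuclideanSpace ℂ (Fin n) → ℂ} (hg : g ∈ bergmanSpace D)
    (h0 : eLpNorm g 2 (volume.restrict D) ≠ 0) :
    ∃ c : ℂ, c • g ∈ bergmanSpace D ∧ eLpNorm (c • g) 2 (volume.restrict D) = 1 ∧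
      ‖c‖ₑ = (eLpNorm g 2 (volume.restrict D))⁻¹ := by
  set N := eLpNorm g 2 (volume.restrict D) with hN
  have hNt : N ≠ ⊤ := hg.2.eLpNorm_ne_top
  have hc : ‖((N.toReal⁻¹ : ℝ) : ℂ)‖ₑ = N⁻¹ := by
    rw [← ofReal_norm, Complex.norm_real, Real.norm_of_nonneg (by positivity),
      ENNReal.ofReal_inv_of_pos (ENNReal.toReal_pos h0 hNt), ENNReal.ofReal_toReal hNt]
  refine ⟨((N.toReal⁻¹ : ℝ) : ℂ), ⟨hg.1.const_smul _, hg.2.const_smul _⟩, ?_, hc⟩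
  rw [eLpNorm_const_smul, hc, ← hN, ENNReal.inv_mul_cancel h0 hNt]

/-- On a bounded set the constants are square-integrable. -/
theorem bergmanKernelDiag_ne_zero (hD : IsOpen D) (hb : Bornology.IsBounded D)
    {z : EuclideanSpace ℂ (Fin n)} (hz : z ∈ D) : bergmanKernelDiag D z ≠ 0 := by
  have hfin : IsFiniteMeasure (volume.restrict D) :=
    ⟨by rw [Measure.restrict_apply_univ]; exact hb.measure_lt_top⟩
  have hg : (fun _ => 1 : EuclideanSpace ℂ (Fin n) → ℂ) ∈ bergmanSpace D :=
    ⟨differentiableOn_const 1, memLp_const 1⟩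
  have h0 : eLpNorm (fun _ => 1 : EuclideanSpace ℂ (Fin n) → ℂ) 2 (volume.restrict D) ≠ 0 := by
    intro h
    rw [eLpNorm_eq_zero_iff aestronglyMeasurable_const two_ne_zero] at h
    have := Measure.eqOn_open_of_ae_eq h hD continuousOn_const continuousOn_const hz
    simp at this
  obtain ⟨c, hc, hc1, hcn⟩ := exists_normalized_bergmanSpace hg h0
  have h1 : ‖(c • (fun _ => 1 : EuclideanSpace ℂ (Fin n) → ℂ)) z‖ₑ ^ 2 ≤ bergmanKernelDiag D z :=
    le_iSup₂ (f := fun (f : EuclideanSpace ℂ (Fin n) → ℂ)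
      (_ : f ∈ {f | f ∈ bergmanSpace D ∧ eLpNorm f 2 (volume.restrict D) ≤ 1}) => ‖f z‖ₑ ^ 2)
      _ ⟨hc, hc1.le⟩
  intro h
  rw [h, nonpos_iff_eq_zero] at h1
  simp only [Pi.smul_apply, smul_eq_mul, mul_one, hcn] at h1
  exact pow_ne_zero 2 (ENNReal.inv_ne_zero.mpr hg.2.eLpNorm_ne_top) h1

/-- The product fg vanishes at z, has norm at most 1 and derivative g(z)f'(z)X there. Normalising it
to norm 1 only increases the derivative. -/
theorem enorm_mul_enorm_fderiv_le_bergmanM (hD : IsOpen D) {z : EuclideanSpace ℂ (Fin n)}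
    (hz : z ∈ D) (X : EuclideanSpace ℂ (Fin n)) {f g : EuclideanSpace ℂ (Fin n) → ℂ}
    (hf : DifferentiableOn ℂ f D) (hf1 : ∀ x ∈ D, ‖f x‖ < 1) (hfz : f z = 0)
    (hg : g ∈ bergmanSpace D) (hg1 : eLpNorm g 2 (volume.restrict D) ≤ 1) :
    ‖g z‖ₑ * ‖fderiv ℂ f z X‖ₑ ≤ bergmanM D z X := by
  by_cases hzero : g z * fderiv ℂ f z X = 0
  · rw [← enorm_mul, hzero, enorm_zero]; exact zero_le
  have hfg : DifferentiableOn ℂ (fun x => f x * g x) D := hf.mul hg.1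
  have hle : ∀ᵐ x ∂volume.restrict D, ‖f x * g x‖ ≤ ‖g x‖ := by
    filter_upwards [ae_restrict_mem hD.measurableSet] with x hx
    rw [norm_mul]
    exact mul_le_of_le_one_left (norm_nonneg _) (hf1 x hx).le
  have hmem : (fun x => f x * g x) ∈ bergmanSpace D :=
    ⟨hfg, hg.2.of_le (hfg.continuousOn.aestronglyMeasurable hD.measurableSet) hle⟩
  have hN1 : eLpNorm (fun x => f x * g x) 2 (volume.restrict D) ≤ 1 :=
    (eLpNorm_mono_ae hle).trans hg1
  have hdf : HasFDerivAt f (fderiv ℂ f z) z := (hf.differentiableAt (hD.mem_nhds hz)).hasFDerivAt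
  have hdg : HasFDerivAt g (fderiv ℂ g z) z :=
    (hg.1.differentiableAt (hD.mem_nhds hz)).hasFDerivAt
  have hder : fderiv ℂ (fun x => f x * g x) z X = g z * fderiv ℂ f z X := by
    rw [(hdf.fun_mul hdg).fderiv]
    simp [hfz]
  have hN0 : eLpNorm (fun x => f x * g x) 2 (volume.restrict D) ≠ 0 := by
    intro h
    rw [eLpNorm_eq_zero_iff hmem.2.1 two_ne_zero] at h
    have h1 := Measure.eqOn_open_of_ae_eq h hD hfg.continuousOn continuousOn_const
    have h2 : (fun x => f x * g x) =ᶠ[𝓝 z] fun _ => 0 := by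
      filter_upwards [hD.mem_nhds hz] with x hx
      exact h1 hx
    rw [h2.fderiv_eq, fderiv_const_apply, zero_apply] at hder
    exact hzero hder.symm
  obtain ⟨c, hc, hc1, hcn⟩ := exists_normalized_bergmanSpace hmem hN0
  have h1 : ‖fderiv ℂ (c • fun x => f x * g x) z X‖ₑ ≤ bergmanM D z X :=
    le_iSup₂ (f := fun (f : EuclideanSpace ℂ (Fin n) → ℂ)
      (_ : f ∈ {f | f ∈ bergmanSpace D ∧ eLpNorm f 2 (volume.restrict D) = 1 ∧ f z = 0}) =>
        ‖fderiv ℂ f z X‖ₑ) _ ⟨hc, hc1, by simp [hfz]⟩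
  rw [fderiv_const_smul (hfg.differentiableAt (hD.mem_nhds hz)), smul_apply,
    hder, enorm_smul, hcn, enorm_mul] at h1
  refine le_trans ?_ h1
  exact le_mul_of_one_le_left zero_le (ENNReal.one_le_inv.mpr hN1)

/-- The Bergman metric dominates the Carathéodory metric. -/
theorem enorm_fderiv_le_bergmanMetric (hD : IsOpen D) (hb : Bornology.IsBounded D)
    {z : EuclideanSpace ℂ (Fin n)} (hz : z ∈ D) (X : EuclideanSpace ℂ (Fin n))
    {f : EuclideanSpace ℂ (Fin n) → ℂ} (hf : DifferentiableOn ℂ f D)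
    (hf1 : ∀ x ∈ D, ‖f x‖ < 1) (hfz : f z = 0) :
    ‖fderiv ℂ f z X‖ₑ ≤ bergmanMetric D z X := by
  have hK0 := bergmanKernelDiag_ne_zero hD hb hz
  have hKt := bergmanKernelDiag_ne_top hD hz
  have hs0 : bergmanKernelDiag D z ^ (1 / 2 : ℝ) ≠ 0 := by
    simp [hK0, hKt]
  have hst : bergmanKernelDiag D z ^ (1 / 2 : ℝ) ≠ ⊤ :=
    ENNReal.rpow_ne_top_of_nonneg (by norm_num) hKt
  rw [bergmanMetric, ENNReal.le_div_iff_mul_le (Or.inl hs0) (Or.inl hst)]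
  rcases eq_or_ne ‖fderiv ℂ f z X‖ₑ 0 with hs | hs
  · rw [hs, zero_mul]; exact zero_le
  rw [mul_comm, ← ENNReal.le_div_iff_mul_le (Or.inl hs) (Or.inl enorm_ne_top)]
  have hle : bergmanKernelDiag D z ≤ (bergmanM D z X / ‖fderiv ℂ f z X‖ₑ) ^ 2 := by
    refine iSup₂_le fun g hg => ?_
    gcongr
    rw [ENNReal.le_div_iff_mul_le (Or.inl hs) (Or.inl enorm_ne_top)]
    exact enorm_mul_enorm_fderiv_le_bergmanM hD hz X hf hf1 hfz hg.1 hg.2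
  refine (ENNReal.rpow_le_rpow hle (by norm_num : (0 : ℝ) ≤ 1 / 2)).trans_eq ?_
  rw [← ENNReal.rpow_natCast, ← ENNReal.rpow_mul]
  norm_num

end Bergman

/-! ### Separating hyperplane at a nearest boundary point -/

section Separation

open Topology

variable {n : ℕ} {D : Set (EuclideanSpace ℂ (Fin n))}

theorem ball_bdryDist_subset (hDo : IsOpen D) {z : EuclideanSpace ℂ (Fin n)} (hz : z ∈ D) :
    Metric.ball z (bdryDist D z) ⊆ D := by
  rcases le_or_gt (bdryDist D z) 0 with h | h
  · rw [Metric.ball_eq_empty.mpr h]; exact empty_subset _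
  refine (convex_ball z _).isPreconnected.subset_left_of_subset_union hDo
    isClosed_closure.isOpen_compl (disjoint_compl_right_iff_subset.mpr subset_closure) ?_
    ⟨z, Metric.mem_ball_self h, hz⟩
  intro x hx
  by_contra hcon
  simp only [mem_union, mem_compl_iff, not_or, not_not] at hcon
  have hfr : x ∈ frontier D := by
    rw [hDo.frontier_eq]; exact ⟨hcon.2, hcon.1⟩
  have := Metric.infDist_le_dist_of_mem (x := z) hfr
  rw [Metric.mem_ball, dist_comm] at hx
  exact absurd hx (not_lt.mpr this)

theorem bdryDist_pos (hDo : IsOpen D) (hfr : (frontier D).Nonempty)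
    {z : EuclideanSpace ℂ (Fin n)} (hz : z ∈ D) : 0 < bdryDist D z := by
  refine (isClosed_frontier.notMem_iff_infDist_pos hfr).mp fun h => ?_
  have : z ∈ D ∩ frontier D := ⟨hz, h⟩
  rw [hDo.inter_frontier_eq] at this
  exact this

/-- Otherwise moving from z in a direction where ℓ is nearly extremal would reach the hyperplane
inside the ball of radius d_D(z), which lies in D. -/
theorem norm_mul_bdryDist_le (hDo : IsOpen D) (hfr : (frontier D).Nonempty)
    {z : EuclideanSpace ℂ (Fin n)} (hz : z ∈ D) {ℓ : EuclideanSpace ℂ (Fin n) →L[ℂ] ℂ}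
    {a : EuclideanSpace ℂ (Fin n)} (hℓ : ∀ x ∈ D, ℓ (x - a) ≠ 0) :
    ‖ℓ‖ * bdryDist D z ≤ ‖ℓ (z - a)‖ := by
  have hd := bdryDist_pos hDo hfr hz
  rw [← le_div_iff₀ hd]
  refine ℓ.opNorm_le_bound (by positivity) fun v => ?_
  by_contra! hv
  rw [div_mul_eq_mul_div, div_lt_iff₀ hd] at hv
  have hv0 : ℓ v ≠ 0 := fun h => by
    rw [h, norm_zero, zero_mul] at hv
    exact absurd hv (not_lt.mpr (by positivity))
  refine hℓ (z - (ℓ (z - a) / ℓ v) • v) (ball_bdryDist_subset hDo hz ?_) ?_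
  · rw [mem_ball_iff_norm, sub_sub_cancel_left, norm_neg, norm_smul, norm_div,
      div_mul_eq_mul_div, div_lt_iff₀ (norm_pos_iff.mpr hv0), mul_comm (bdryDist D z)]
    exact hv
  · rw [sub_right_comm, map_sub, map_smul, smul_eq_mul, div_mul_cancel₀ _ hv0, sub_self]

/-- At a nearest boundary point a `ℂ`-convex domain is separated by a complex hyperplane, and the
resulting projection controls the ratio of distances to the boundary. -/
theorem exists_projection (hDo : IsOpen D) (hfr : (frontier D).Nonempty) (hD : LineLog D)
    {w : EuclideanSpace ℂ (Fin n)} (hw : w ∈ D) :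
    ∃ (a : EuclideanSpace ℂ (Fin n)) (ℓ : EuclideanSpace ℂ (Fin n) →L[ℂ] ℂ),
      IsOpen ((fun x => ℓ (x - a)) '' D) ∧ HasContLog ((fun x => ℓ (x - a)) '' D) ∧
      (0 : ℂ) ∉ (fun x => ℓ (x - a)) '' D ∧
      ∀ z ∈ D, Real.log (bdryDist D z / bdryDist D w) ≤
        Real.log (‖ℓ (z - a)‖ / ‖ℓ (w - a)‖) := by
  obtain ⟨a, ha, hwa⟩ := isClosed_frontier.exists_infDist_eq_dist hfr w
  have haD : a ∉ D := fun h => by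
    have : a ∈ D ∩ frontier D := ⟨h, ha⟩
    rw [hDo.inter_frontier_eq] at this
    exact this
  have hDa := hD.vadd a
  have hDao : IsOpen {x | x + a ∈ D} := hDo.preimage (by fun_prop)
  obtain ⟨ℓ', hℓ'⟩ := hDa.exists_hyperplane hDao ⟨w - a, by simpa using hw⟩ (by simpa using haD)
  set ℓ : EuclideanSpace ℂ (Fin n) →L[ℂ] ℂ := LinearMap.toContinuousLinearMap ℓ' with hℓdef
  have hℓ : ∀ x ∈ D, ℓ (x - a) ≠ 0 := fun x hx => hℓ' (x - a) (by simpa using hx)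
  have hsurj : Function.Surjective ℓ' := fun c =>
    ⟨(c / ℓ' (w - a)) • (w - a), by
      rw [map_smul, smul_eq_mul]
      exact div_mul_cancel₀ _ (hℓ w hw)⟩
  have hopen : IsOpenMap ℓ := LinearMap.isOpenMap_of_finiteDimensional ℓ' hsurj
  have himg : (fun x => ℓ (x - a)) '' D = ℓ '' {x | x + a ∈ D} := by
    ext c
    constructor
    · rintro ⟨x, hx, rfl⟩
      exact ⟨x - a, by simpa using hx, rfl⟩
    · rintro ⟨x, hx, rfl⟩
      exact ⟨x + a, hx, by simp⟩
  refine ⟨a, ℓ, himg ▸ hopen _ hDao, himg ▸ hDa.hasContLog_image hDao ℓ hopen, ?_, fun z hz => ?_⟩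
  · rintro ⟨x, hx, h⟩
    exact hℓ x hx h
  have hdz := bdryDist_pos hDo hfr hz
  have hdw := bdryDist_pos hDo hfr hw
  have hℓw : 0 < ‖ℓ (w - a)‖ := norm_pos_iff.mpr (hℓ w hw)
  have h1 := norm_mul_bdryDist_le hDo hfr hz hℓ
  have h2 : ‖ℓ (w - a)‖ ≤ ‖ℓ‖ * bdryDist D w := by
    rw [bdryDist, hwa, dist_eq_norm]
    exact ℓ.le_opNorm _
  refine Real.log_le_log (div_pos hdz hdw) ?_
  rw [div_le_div_iff₀ hdw hℓw]
  nlinarith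

end Separation

/-! ### Lower bounds for the two distances -/

section Main

open Topology

variable {n : ℕ} {D : Set (EuclideanSpace ℂ (Fin n))}

/-- `ENNReal.ofReal` truncates negative values to 0, which is harmless in a lower bound for a
nonnegative quantity. -/
theorem ereal_coe_le_of_ofReal_le {r : ℝ} {x : ℝ≥0∞} (h : ENNReal.ofReal r ≤ x) :
    (r : EReal) ≤ (x : EReal) := by
  refine le_trans ?_ (EReal.coe_ennreal_le_coe_ennreal_iff.mpr h)
  rw [EReal.coe_ennreal_ofReal]
  exact EReal.coe_le_coe_iff.mpr (le_max_left _ _)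

theorem le_caratheodoryDist (hDo : IsOpen D) (hfr : (frontier D).Nonempty) (hD : LineLog D)
    {z w : EuclideanSpace ℂ (Fin n)} (hz : z ∈ D) (hw : w ∈ D) :
    ENNReal.ofReal (1 / 4 * Real.log (bdryDist D z / bdryDist D w)) ≤ caratheodoryDist D z w := by
  obtain ⟨a, ℓ, hGo, hGl, hG0, hlog⟩ := exists_projection hDo hfr hD hw
  rcases eq_or_ne (caratheodoryDist D z w) ⊤ with htop | htop
  · rw [htop]; exact le_top
  refine ENNReal.ofReal_le_of_le_toReal ?_
  have hmaps : MapsTo (fun x => ℓ (x - a)) D ((fun x => ℓ (x - a)) '' D) := mapsTo_image _ _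
  have h1 := log_div_le_of_artanh_le hGo hGl hG0 (hmaps hz) (hmaps hw)
    (T := (caratheodoryDist D z w).toReal) fun f hf hf1 hfz => by
      refine (ENNReal.ofReal_le_iff_le_toReal htop).mp ?_
      exact le_iSup₂ (f := fun (f : EuclideanSpace ℂ (Fin n) → ℂ)
        (_ : f ∈ {f : EuclideanSpace ℂ (Fin n) → ℂ |
          DifferentiableOn ℂ f D ∧ MapsTo f D (Metric.ball 0 1) ∧ f z = 0}) =>
            ENNReal.ofReal (Real.artanh ‖f w‖)) (fun x => f (ℓ (x - a)))
        ⟨hf.comp (by fun_prop) hmaps, fun x hx => mem_ball_zero_iff.mpr (hf1 _ (hmaps hx)), hfz⟩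
  have h2 := hlog z hz
  linarith

theorem le_bergmanDist (hDo : IsOpen D) (hb : Bornology.IsBounded D)
    (hfr : (frontier D).Nonempty) (hD : LineLog D)
    {z w : EuclideanSpace ℂ (Fin n)} (hz : z ∈ D) (hw : w ∈ D) :
    ENNReal.ofReal (1 / 4 * Real.log (bdryDist D z / bdryDist D w)) ≤ bergmanDist D z w := by
  obtain ⟨a, ℓ, hGo, hGl, hG0, hlog⟩ := exists_projection hDo hfr hD hw
  set G : Set ℂ := (fun x => ℓ (x - a)) '' D with hG
  have hmaps : MapsTo (fun x => ℓ (x - a)) D G := mapsTo_image _ _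
  have hne : ∀ c ∈ G, c ≠ 0 := fun c hc h => hG0 (h ▸ hc)
  -- Near-extremal planar functions composed with the projection compete for the Carathéodory metric
  -- of D; then ρ → 1.
  have hmetric : ∀ x ∈ D, ∀ X, ‖ℓ X / ℓ (x - a)‖ₑ ≤ 4 * bergmanMetric D x X := by
    intro x hx X
    have hx0 := hne _ (hmaps hx)
    have hρ : ∀ ρ ∈ Ioo (0 : ℝ) 1,
        ENNReal.ofReal (ρ * ‖ℓ X / ℓ (x - a)‖) ≤ 4 * bergmanMetric D x X := by
      intro ρ hρ
      obtain ⟨f, hf, hf1, hfx, hfd⟩ := exists_deriv_ge hGo hGl hG0 (hmaps hx) hρ.1 hρ.2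
      have h1 := enorm_fderiv_le_bergmanMetric hDo hb hx X
        (f := fun y => f (ℓ (y - a))) (hf.comp (by fun_prop) hmaps)
        (fun y hy => hf1 _ (hmaps hy)) hfx
      have h2 : HasFDerivAt (fun y => ℓ (y - a)) ℓ x :=
        ℓ.hasFDerivAt.comp x ((hasFDerivAt_id x).sub_const a)
      have h3 := ((hf.differentiableAt (hGo.mem_nhds (hmaps hx))).hasDerivAt).comp_hasFDerivAt x h2
      have h4 : fderiv ℂ (fun y => f (ℓ (y - a))) x X = deriv f (ℓ (x - a)) * ℓ X := by
        rw [show (fun y => f (ℓ (y - a))) = f ∘ fun y => ℓ (y - a) from rfl, h3.fderiv]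
        simp
      rw [h4] at h1
      refine le_trans ?_ (mul_le_mul_right h1 4)
      rw [← ofReal_norm, ← ENNReal.ofReal_ofNat 4, ← ENNReal.ofReal_mul (by norm_num)]
      refine ENNReal.ofReal_le_ofReal ?_
      have hpos : 0 < ‖ℓ (x - a)‖ := norm_pos_iff.mpr hx0
      rw [norm_div, norm_mul, ← mul_div_assoc, div_le_iff₀ hpos]
      have := mul_le_mul_of_nonneg_right hfd (norm_nonneg (ℓ X))
      linarith
    have hlim : Filter.Tendsto (fun ρ : ℝ => ENNReal.ofReal (ρ * ‖ℓ X / ℓ (x - a)‖)) (𝓝[<] 1)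
        (𝓝 (ENNReal.ofReal (1 * ‖ℓ X / ℓ (x - a)‖))) := by
      have : Continuous fun ρ : ℝ => ENNReal.ofReal (ρ * ‖ℓ X / ℓ (x - a)‖) :=
        ENNReal.continuous_ofReal.comp (by fun_prop)
      exact this.continuousAt.tendsto.mono_left nhdsWithin_le_nhds
    rw [one_mul, ofReal_norm] at hlim
    refine le_of_tendsto hlim ?_
    filter_upwards [Ioo_mem_nhdsLT one_pos] with ρ h
    exact hρ ρ h
  -- With a logarithm on G, the length of the projected curve for |dζ|/|ζ| is at least the change of
  -- L, whose real part is log|ζ|.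
  obtain ⟨L, hL, hLe⟩ := hGl.exists_differentiableOn hGo (h := fun c => c) differentiableOn_id hne
  have hLd : ∀ c ∈ G, HasDerivAt L (1 / c) c := by
    intro c hc
    have h1 := (hL.differentiableAt (hGo.mem_nhds hc)).hasDerivAt
    have h2 : (fun y : ℂ => y) =ᶠ[𝓝 c] fun y => Complex.exp (L y) := by
      filter_upwards [hGo.mem_nhds hc] with y hy
      exact (hLe y hy).symm
    have h3 := h2.deriv_eq
    rw [deriv_id'', h1.cexp.deriv, hLe c hc] at h3
    refine h1.congr_deriv ?_
    rw [eq_div_iff (hne c hc), mul_comm]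
    exact h3.symm
  refine le_iInf₂ fun γ hγ => ?_
  obtain ⟨hγs, hγD, hγ0, hγ1⟩ := hγ
  set c : ℝ → ℂ := fun t => ℓ (γ t - a) with hc
  have hcG : MapsTo c (Icc 0 1) G := fun t ht => hmaps (hγD ht)
  have hcs : ContDiffOn ℝ 1 c (Icc 0 1) :=
    ((ℓ.restrictScalars ℝ).contDiff.comp_contDiffOn
      ((hγs.of_le (by simp)).sub contDiffOn_const))
  have hLc : ContDiffOn ℝ 1 (L ∘ c) (Icc 0 1) :=
    ((hL.contDiffOn hGo (n := 1)).restrict_scalars ℝ).comp hcs hcG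
  have hder : ∀ t ∈ Icc (0 : ℝ) 1, ‖derivWithin (L ∘ c) (Icc 0 1) t‖ₑ ≤
      4 * bergmanMetric D (γ t) (derivWithin γ (Icc 0 1) t) := by
    intro t ht
    have hu : UniqueDiffWithinAt ℝ (Icc (0 : ℝ) 1) t := uniqueDiffOn_Icc zero_lt_one t ht
    have h1 : HasDerivWithinAt γ (derivWithin γ (Icc 0 1) t) (Icc 0 1) t :=
      (hγs.differentiableOn (by simp) t ht).hasDerivWithinAt
    have h2 : HasDerivWithinAt c (ℓ (derivWithin γ (Icc 0 1) t)) (Icc 0 1) t :=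
      (ℓ.restrictScalars ℝ).hasFDerivAt.comp_hasDerivWithinAt t (h1.sub_const a)
    have h3 := ((hLd _ (hcG ht)).comp_hasDerivWithinAt t h2).derivWithin hu
    rw [h3, one_div, ← div_eq_inv_mul]
    exact hmetric _ (hγD ht) _
  have h1 := enorm_sub_le_lintegral_derivWithin_Icc_of_contDiffOn_Icc hLc zero_le_one
  have h2 : ∫⁻ t in Icc (0 : ℝ) 1, ‖derivWithin (L ∘ c) (Icc 0 1) t‖ₑ ≤
      4 * ∫⁻ t in Icc (0 : ℝ) 1, bergmanMetric D (γ t) (derivWithin γ (Icc 0 1) t) := by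
    -- Since 4 is finite, no measurability of the Bergman metric along the curve is needed.
    rw [← lintegral_const_mul' _ _ (by simp)]
    exact setLIntegral_mono' measurableSet_Icc hder
  have h3 : Real.log (bdryDist D z / bdryDist D w) ≤ ‖(L ∘ c) 1 - (L ∘ c) 0‖ := by
    refine (hlog z hz).trans ?_
    have hnorm : ∀ y ∈ G, ‖y‖ = Real.exp (L y).re := fun y hy => by
      rw [← Complex.norm_exp, hLe y hy]
    rw [hnorm _ (hmaps hz), hnorm _ (hmaps hw), ← Real.exp_sub, Real.log_exp]
    have h0 : c 0 = ℓ (z - a) := by simp only [hc, hγ0]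
    have h1 : c 1 = ℓ (w - a) := by simp only [hc, hγ1]
    rw [norm_sub_rev, Function.comp_apply, Function.comp_apply, h0, h1, ← Complex.sub_re]
    exact Complex.re_le_norm _
  have h4 : ENNReal.ofReal (Real.log (bdryDist D z / bdryDist D w)) ≤
      4 * ∫⁻ t in Icc (0 : ℝ) 1, bergmanMetric D (γ t) (derivWithin γ (Icc 0 1) t) := by
    refine le_trans ?_ (h1.trans h2)
    rw [← ofReal_norm]
    exact ENNReal.ofReal_le_ofReal h3
  rw [ENNReal.ofReal_mul (by norm_num), one_div, ENNReal.ofReal_inv_of_pos (by norm_num),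
    ENNReal.ofReal_ofNat, mul_comm, ← div_eq_mul_inv]
  refine ENNReal.div_le_of_le_mul ?_
  rwa [mul_comm]

end Main
theorem proposition2 {n : ℕ} (D : Set (EuclideanSpace ℂ (Fin n)))
    (hDo : IsOpen D) (hDc : IsConnected D) (hDp : D ≠ Set.univ) (hD : IsCConvex D) :
    (∀ z ∈ D, ∀ w ∈ D,
      ((1 / 4 * Real.log (bdryDist D z / (4 * bdryDist D w)) : ℝ) : EReal)
        ≤ (caratheodoryDist D z w : EReal)) ∧
    (Bornology.IsBounded D → ∀ K ⊆ D, IsCompact K → ∃ c : ℝ, 0 < c ∧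
      ∀ z ∈ K, ∀ w ∈ D,
        ((-(1 / 4) * Real.log (bdryDist D w) - c : ℝ) : EReal)
          ≤ (bergmanDist D z w : EReal)) := by
  have hL := hD.lineLog hDo
  have hfr : (frontier D).Nonempty := nonempty_frontier_iff.mpr ⟨hDc.nonempty, hDp⟩
  have hpos : ∀ z ∈ D, 0 < bdryDist D z := fun z hz => bdryDist_pos hDo hfr hz
  refine ⟨fun z hz w hw => ?_, fun hb K hKD hK => ?_⟩
  · refine ereal_coe_le_of_ofReal_le (le_trans (ENNReal.ofReal_le_ofReal ?_)
      (le_caratheodoryDist hDo hfr hL hz hw))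
    have h1 := hpos z hz
    have h2 := hpos w hw
    gcongr
    linarith
  · rcases K.eq_empty_or_nonempty with rfl | hKne
    · exact ⟨1, one_pos, by simp⟩
    obtain ⟨z₀, hz₀, hmin⟩ := hK.exists_isMinOn hKne
      (Metric.continuous_infDist_pt (frontier D)).continuousOn
    -- `z₀` minimises the boundary distance on `K`; the maximum with 1 only ensures positivity.
    refine ⟨max 1 (-(1 / 4) * Real.log (bdryDist D z₀)), by positivity, fun z hz w hw => ?_⟩
    refine ereal_coe_le_of_ofReal_le (le_trans (ENNReal.ofReal_le_ofReal ?_)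
      (le_bergmanDist hDo hb hfr hL (hKD hz) hw))
    have h1 : Real.log (bdryDist D z₀) ≤ Real.log (bdryDist D z) :=
      Real.log_le_log (hpos z₀ (hKD hz₀)) (hmin hz)
    have h2 := le_max_right 1 (-(1 / 4) * Real.log (bdryDist D z₀))
    rw [Real.log_div (hpos z (hKD hz)).ne' (hpos w hw).ne']
    linarith
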